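/- Let $k$ be a field and $H$ a Hopf algebra over $k$ with bijective antipode $S$; we use Sweedler notation $\Delta(h)=h_{(1)}\otimes h_{(2)}$. Let $H_{par}$ be the quotient of the tensor algebra of the vector space $H$, with $[h]$ denoting the class of $h\in H$, by the relations $[1_H]=1$, $[h][l_{(1)}][S(l_{(2)})]=[hl_{(1)}][S(l_{(2)})]$ and $[h_{(1)}][S(h_{(2)})][l]=[h_{(1)}][S(h_{(2)})l]$ for all $h,l\in H$. Let $A_{par}\subseteq H_{par}$ be the subalgebra generated by the elements $\varepsilon_h=[h_{(1)}][S(h_{(2)})]$, $h\in H$, with the symmetric partial action $h\bullet a=[h_{(1)}]\,a\,[S(h_{(2)})]$ of $H$. The partial smash product $A_{par}\underline{\#}H$ is the subspace $(A_{par}\otimes H)(1\otimes 1)$ of $A_{par}\otimes H$ with multiplication $(a\otimes h)(b\otimes l)=a(h_{(1)}\bullet b)\otimes h_{(2)}l$; it is a unital algebra, spanned by the elements $a\#h=a(h_{(1)}\bullet 1)\otimes h_{(2)}$. Let $\{A_{par},A_{par}\}$ be the space of linear maps $f:A_{par}\otimes H\to A_{par}$ with $f(h_{(1)}\bullet a\otimes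 h_{(2)}l)=h\bullet f(a\otimes l)$ for all $h,l\in H$, $a\in A_{par}$. It is a unital algebra with product $(f\circ g)(a\otimes h)=g(f(a\otimes h_{(1)})\otimes h_{(2)})$ and unit $a\otimes h\mapsto\epsilon(h)a$, and an $H$-module algebra via $(h\rightharpoonup f)(a\otimes l)=f(a\otimes lh)$. Let $\theta:A_{par}\to\{A_{par},A_{par}\}$ be given by $\theta(a)(b\otimes h)=b(h\bullet a)$, and let $H_{glob}=\{A_{par},A_{par}\}\#H$ be the smash product, i.e. $\{A_{par},A_{par}\}\otimes H$ with multiplication $(f\#h)(g\#l)=f\circ(h_{(1)}\rightharpoonup g)\,\#\,h_{(2)}l$. **Theorem.** Suppose that the globalization $(\{A_{par},A_{par}\},\theta)$ of $A_{par}$ is proper, i.e. that $\{A_{par},A_{par}\}=H\rightharpoonup\theta(A_{par})$ (every element is a finite sum of elements $h\rightharpoonup\theta(a)$ with $h\in H$, $a\in A_{par}$). Then the $k$-algebra $H_{glob}$ is Morita equivalent to $H_{par}$ (their module categories are $k$-linearly equivalent), and $H_{par}$ is isomorphic, as a $k$-algebra, to $A_{par}\underline{\#}H$ by an isomorphism $A_{par}\underline{\#}H\to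 H_{par}$ with $a\#h\mapsto a[h]$. -/

import Mathlib

open scoped TensorProduct

namespace PartialHopf

open Coalgebra HopfAlgebra

noncomputable section

section Sweedler

variable {k H B V : Type*} [Field k] [Ring H] [HopfAlgebra k H] [Ring B] [Algebra k B]
  [AddCommGroup V] [Module k V]

/-- The convolution product `h ↦ f(h₍₁₎) g(h₍₂₎)`. -/
def conv (f g : H →ₗ[k] B) : H →ₗ[k] B :=
  LinearMap.mul' k B ∘ₗ TensorProduct.map f g ∘ₗ comul

theorem conv_apply {ι : Type*} (f g : H →ₗ[k] B) {h : H} (r : Repr k h ι) :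
    conv f g h = ∑ i ∈ r.index, f (r.left i) * g (r.right i) := by
  simp [conv, ← r.eq]

theorem conv_assoc (f g l : H →ₗ[k] B) : conv (conv f g) l = conv f (conv g l) :=
  congrArg WithConv.ofConv (mul_assoc (WithConv.toConv f) (WithConv.toConv g) (WithConv.toConv l))

theorem conv_add (f g l : H →ₗ[k] B) : conv f (g + l) = conv f g + conv f l := by
  ext h; simp [conv_apply _ _ (ℛ k h), mul_add, Finset.sum_add_distrib]

theorem add_conv (f g l : H →ₗ[k] B) : conv (f + g) l = conv f l + conv g l := by
  ext h; simp [conv_apply _ _ (ℛ k h), add_mul, Finset.sum_add_distrib]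

theorem conv_unit (f : H →ₗ[k] B) : conv f (Algebra.linearMap k B ∘ₗ counit) = f :=
  congrArg WithConv.ofConv (mul_one (WithConv.toConv f))

theorem unit_conv (f : H →ₗ[k] B) : conv (Algebra.linearMap k B ∘ₗ counit) f = f :=
  congrArg WithConv.ofConv (one_mul (WithConv.toConv f))

theorem sum_coassoc (Ψ : H →ₗ[k] H →ₗ[k] H →ₗ[k] V) (h : H) :
    ∑ i ∈ (ℛ k h).index, ∑ j ∈ (ℛ k ((ℛ k h).left i)).index,
        Ψ ((ℛ k ((ℛ k h).left i)).left j) ((ℛ k ((ℛ k h).left i)).right j) ((ℛ k h).right i) =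
      ∑ i ∈ (ℛ k h).index, ∑ j ∈ (ℛ k ((ℛ k h).right i)).index,
        Ψ ((ℛ k h).left i) ((ℛ k ((ℛ k h).right i)).left j) ((ℛ k ((ℛ k h).right i)).right j) := by
  have := sum_tmul_tmul_eq (ℛ k h) (fun i => ℛ k ((ℛ k h).left i))
    (fun i => ℛ k ((ℛ k h).right i))
  have := congrArg (TensorProduct.lift ((TensorProduct.uncurry (.id k) H H V).comp Ψ)) this
  simpa using this

theorem sum_counit_left (Φ : H →ₗ[k] V) (h : H) :
    ∑ i ∈ (ℛ k h).index, counit (R := k) ((ℛ k h).left i) • Φ ((ℛ k h).right i) = Φ h := by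
  conv_rhs => rw [← sum_counit_smul (ℛ k h)]
  simp

theorem sum_counit_right (Φ : H →ₗ[k] V) (h : H) :
    ∑ i ∈ (ℛ k h).index, counit (R := k) ((ℛ k h).right i) • Φ ((ℛ k h).left i) = Φ h := by
  have := congrArg (TensorProduct.lift ((LinearMap.lsmul k V).flip.comp Φ))
    (sum_tmul_counit_eq (ℛ k h))
  simpa only [map_sum, TensorProduct.lift.tmul, LinearMap.comp_apply, LinearMap.flip_apply,
    LinearMap.lsmul_apply, one_smul] using this

theorem conv_mulRight (f g : H →ₗ[k] B) (b : B) :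
    conv f (LinearMap.mulRight k b ∘ₗ g) = LinearMap.mulRight k b ∘ₗ conv f g := by
  ext h; simp [conv_apply _ _ (ℛ k h), mul_assoc]

theorem mulLeft_conv (f g : H →ₗ[k] B) (b : B) :
    conv (LinearMap.mulLeft k b ∘ₗ f) g = LinearMap.mulLeft k b ∘ₗ conv f g := by
  ext h; simp [conv_apply _ _ (ℛ k h), mul_assoc]

theorem conv_apply_mul (f g : H →ₗ[k] B) (h l : H) :
    conv f g (h * l) = ∑ i ∈ (ℛ k h).index, ∑ j ∈ (ℛ k l).index,
      f ((ℛ k h).left i * (ℛ k l).left j) * g ((ℛ k h).right i * (ℛ k l).right j) := by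
  rw [conv_apply _ _ ((ℛ k h).mul (ℛ k l)), Coalgebra.Repr.mul]
  simp [Finset.sum_product]

theorem conv_comp_mulRight (f g : H →ₗ[k] B) (l : H) :
    conv f g ∘ₗ LinearMap.mulRight k l = ∑ j ∈ (ℛ k l).index,
      conv (f ∘ₗ LinearMap.mulRight k ((ℛ k l).left j))
        (g ∘ₗ LinearMap.mulRight k ((ℛ k l).right j)) := by
  ext h
  rw [LinearMap.comp_apply, LinearMap.mulRight_apply, conv_apply_mul, LinearMap.sum_apply]
  simp only [conv_apply _ _ (ℛ k h)]
  rw [Finset.sum_comm]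
  simp

end Sweedler

section PartialRep

variable {k H B : Type*} [Field k] [Ring H] [HopfAlgebra k H] [Ring B] [Algebra k B]

/-- The map `h ↦ π(h₍₁₎) π(S(h₍₂₎))`. -/
def epsOf (π : H →ₗ[k] B) : H →ₗ[k] B :=
  conv π (π ∘ₗ antipode k)

/-- The map `h ↦ π(h₍₁₎) b π(S(h₍₂₎))`. -/
def conjOf (π : H →ₗ[k] B) (b : B) : H →ₗ[k] B :=
  conv (LinearMap.mulRight k b ∘ₗ π) (π ∘ₗ antipode k)

/-- Partial representations of a Hopf algebra:
`π(1) = 1`, `π(h) π(l₍₁₎) π(S(l₍₂₎)) = π(h l₍₁₎) π(S(l₍₂₎))` and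
`π(h₍₁₎) π(S(h₍₂₎)) π(l) = π(h₍₁₎) π(S(h₍₂₎) l)`. -/
structure IsPartialRep (π : H →ₗ[k] B) : Prop where
  map_one : π 1 = 1
  mul_eps : ∀ h l : H, π h * epsOf π l =
    conv (π ∘ₗ LinearMap.mulLeft k h) (π ∘ₗ antipode k) l
  eps_mul : ∀ h l : H, epsOf π h * π l =
    conv π (π ∘ₗ LinearMap.mulRight k l ∘ₗ antipode k) h

/-- `T` satisfies `π(h) T(l) = T(h₍₁₎ l) π(h₍₂₎)`. -/
def IsCovariant (π T : H →ₗ[k] B) : Prop :=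
  ∀ h l : H, π h * T l = conv (T ∘ₗ LinearMap.mulRight k l) π h

namespace IsCovariant

variable {π S T : H →ₗ[k] B}

theorem mulRight_comp (hT : IsCovariant π T) (l : H) :
    LinearMap.mulRight k (T l) ∘ₗ π = conv (T ∘ₗ LinearMap.mulRight k l) π := by
  ext h; exact hT h l

theorem mulRight_one (hT : IsCovariant π T) :
    LinearMap.mulRight k (T 1) ∘ₗ π = conv T π := by
  rw [hT.mulRight_comp]; simp [LinearMap.mulRight_one]

theorem translate (hT : IsCovariant π T) (l : H) :
    IsCovariant π (T ∘ₗ LinearMap.mulRight k l) := by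
  intro h g
  rw [LinearMap.comp_apply, LinearMap.mulRight_apply, hT]
  congr 2
  ext; simp [mul_assoc]

protected theorem add (hS : IsCovariant π S) (hT : IsCovariant π T) :
    IsCovariant π (S + T) := by
  intro h l
  rw [LinearMap.add_apply, mul_add, hS, hT, LinearMap.add_comp, add_conv, LinearMap.add_apply]

protected theorem smul (hT : IsCovariant π T) (c : k) : IsCovariant π (c • T) := by
  intro h l
  simp [hT h l, conv_apply _ _ (ℛ k h), Finset.smul_sum]

protected theorem conv (hS : IsCovariant π S) (hT : IsCovariant π T) :
    IsCovariant π (conv S T) := by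
  intro h l
  rw [conv_comp_mulRight, conv_apply _ _ (ℛ k l), Finset.mul_sum]
  have : ∀ (s : Finset (H × H)) (F : H × H → (H →ₗ[k] B)),
      conv (∑ j ∈ s, F j) π = ∑ j ∈ s, conv (F j) π := by
    intro s F
    induction s using Finset.cons_induction with
    | empty => ext; simp [conv]
    | cons a s ha ih => rw [Finset.sum_cons, Finset.sum_cons, add_conv, ih]
  rw [this, LinearMap.sum_apply]
  refine Finset.sum_congr rfl fun j _ => ?_
  rw [← mul_assoc, hS, conv_assoc, ← hT.mulRight_comp, conv_mulRight]
  simp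

end IsCovariant

namespace IsPartialRep

variable {π : H →ₗ[k] B}

theorem eps_conv_mulRight (hπ : IsPartialRep π) (l : H) :
    conv (epsOf π) (π ∘ₗ LinearMap.mulRight k l) = LinearMap.mulRight k (π l) ∘ₗ π := by
  ext h
  let Ψ : H →ₗ[k] H →ₗ[k] H →ₗ[k] B := LinearMap.mk₂ k
    (fun x y => LinearMap.mulLeft k (π x) ∘ₗ π ∘ₗ LinearMap.mulRight k l ∘ₗ
      LinearMap.mulLeft k (antipode k y))
    (by intros; ext; simp [add_mul]) (by intros; ext; simp)
    (by intros; ext; simp [add_mul, mul_add]) (by intros; ext; simp)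
  have := sum_coassoc Ψ h
  simp only [Ψ, LinearMap.mk₂_apply, LinearMap.comp_apply, LinearMap.mulLeft_apply,
    LinearMap.mulRight_apply] at this
  rw [conv_apply _ _ (ℛ k h)]
  simp only [hπ.eps_mul, conv_apply _ _ (ℛ k _), LinearMap.comp_apply, LinearMap.mulRight_apply]
  simp only [mul_assoc] at this
  rw [this]
  simp only [← mul_assoc, ← Finset.mul_sum, ← map_sum, ← Finset.sum_mul,
    sum_antipode_mul_eq_smul]
  simp only [smul_mul_assoc, one_mul, map_smul, mul_smul_comm]
  exact sum_counit_right (LinearMap.mulRight k (π l) ∘ₗ π) h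

theorem eps_conv (hπ : IsPartialRep π) : conv (epsOf π) π = π := by
  have := hπ.eps_conv_mulRight 1
  rwa [hπ.map_one, LinearMap.mulRight_one, LinearMap.mulRight_one] at this

theorem eps_one (hπ : IsPartialRep π) : epsOf π 1 = 1 := by
  simp [epsOf, conv, Algebra.TensorProduct.one_def, hπ.map_one]

theorem eps_isCovariant (hπ : IsPartialRep π) : IsCovariant π (epsOf π) := by
  intro h l
  rw [hπ.mul_eps, conv_apply _ _ (ℛ k l), conv_apply _ _ (ℛ k h)]
  simp only [LinearMap.comp_apply, LinearMap.mulRight_apply, LinearMap.mulLeft_apply, hπ.eps_mul,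
    conv_apply_mul, antipode_mul_antidistrib]
  rw [Finset.sum_congr rfl fun i _ => Finset.sum_comm, Finset.sum_comm]
  refine Finset.sum_congr rfl fun j _ => ?_
  let Ψ : H →ₗ[k] H →ₗ[k] H →ₗ[k] B := LinearMap.mk₂ k
    (fun x y => LinearMap.mulLeft k (π (x * (ℛ k l).left j)) ∘ₗ π ∘ₗ
      LinearMap.mulLeft k (antipode k ((ℛ k l).right j) * antipode k y))
    (by intros; ext; simp [add_mul]) (by intros; ext; simp)
    (by intros; ext; simp [add_mul, mul_add, mul_assoc]) (by intros; ext; simp [mul_assoc])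
  have := sum_coassoc Ψ h
  simp only [Ψ, LinearMap.mk₂_apply, LinearMap.comp_apply, LinearMap.mulLeft_apply] at this
  rw [this]
  simp only [← Finset.mul_sum, ← map_sum, mul_assoc, sum_antipode_mul_eq_smul]
  simp only [mul_one, map_smul, mul_smul_comm]
  exact (sum_counit_right (LinearMap.mulRight k (π (antipode k ((ℛ k l).right j))) ∘ₗ π ∘ₗ
    LinearMap.mulRight k ((ℛ k l).left j)) h).symm

end IsPartialRep

/-- The elements `b` whose conjugates `h₍₁₎ b S(h₍₂₎)` depend covariantly on `h`. -/
def IsGood (π : H →ₗ[k] B) (b : B) : Prop := IsCovariant π (conjOf π b)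

namespace IsPartialRep

variable {π : H →ₗ[k] B}

theorem conjOf_apply_one (hπ : IsPartialRep π) (b : B) : conjOf π b 1 = b := by
  simp [conjOf, conv, Algebra.TensorProduct.one_def, hπ.map_one]

theorem conjOf_one (π : H →ₗ[k] B) : conjOf π 1 = epsOf π := by
  simp [conjOf, epsOf, LinearMap.mulRight_one]

theorem mulRight_comp_of_good (hπ : IsPartialRep π) {b : B} (hb : IsGood π b) :
    LinearMap.mulRight k b ∘ₗ π = conv (conjOf π b) π := by
  have := hb.mulRight_one
  rwa [hπ.conjOf_apply_one] at this

theorem conjOf_mul (hπ : IsPartialRep π) {b : B} (hb : IsGood π b) (c : B) :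
    conjOf π (b * c) = conv (conjOf π b) (conjOf π c) := by
  have : LinearMap.mulRight k (b * c) ∘ₗ π =
      LinearMap.mulRight k c ∘ₗ (LinearMap.mulRight k b ∘ₗ π) := by ext; simp [mul_assoc]
  rw [conjOf, this, hπ.mulRight_comp_of_good hb, ← conv_mulRight, conv_assoc]; rfl

theorem conjOf_eps (hπ : IsPartialRep π) (l : H) :
    conjOf π (epsOf π l) = conv (epsOf π ∘ₗ LinearMap.mulRight k l) (epsOf π) := by
  rw [conjOf, hπ.eps_isCovariant.mulRight_comp, conv_assoc]; rfl

theorem isGood_eps (hπ : IsPartialRep π) (l : H) : IsGood π (epsOf π l) := by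
  rw [IsGood, hπ.conjOf_eps]
  exact (hπ.eps_isCovariant.translate l).conv hπ.eps_isCovariant

theorem isGood_mul (hπ : IsPartialRep π) {b c : B} (hb : IsGood π b) (hc : IsGood π c) :
    IsGood π (b * c) := by
  rw [IsGood, hπ.conjOf_mul hb]
  exact IsCovariant.conv hb hc

theorem conjOf_add (π : H →ₗ[k] B) (b c : B) : conjOf π (b + c) = conjOf π b + conjOf π c := by
  rw [conjOf, conjOf, conjOf, ← add_conv]
  congr 1; ext; simp [mul_add]

theorem conjOf_smul (π : H →ₗ[k] B) (r : k) (b : B) : conjOf π (r • b) = r • conjOf π b := by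
  ext h; simp [conjOf, conv_apply _ _ (ℛ k h), Finset.smul_sum]

theorem conv_conjOf_eps (hπ : IsPartialRep π) {b : B} (hb : IsGood π b) :
    conv (conjOf π b) (epsOf π) = conjOf π b := by
  rw [epsOf, ← conv_assoc, ← hπ.mulRight_comp_of_good hb]; rfl

theorem conv_mulRight_antipode (hπ : IsPartialRep π) {b : B} (hb : IsGood π b) (x : H) :
    conv (LinearMap.mulRight k b ∘ₗ π) (π ∘ₗ LinearMap.mulRight k x ∘ₗ antipode k) =
      LinearMap.mulRight k (π x) ∘ₗ conjOf π b := by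
  have : conv π (π ∘ₗ LinearMap.mulRight k x ∘ₗ antipode k) =
      LinearMap.mulRight k (π x) ∘ₗ epsOf π := by
    ext h; simp [hπ.eps_mul]
  rw [hπ.mulRight_comp_of_good hb, conv_assoc, this, conv_mulRight, hπ.conv_conjOf_eps hb]

/-- `h ▹ (l ▹ b) = (h₍₁₎ l ▹ b) (h₍₂₎ ▹ 1)` for `h ▹ b = π(h₍₁₎) b π(S(h₍₂₎))`. -/
theorem conjOf_conjOf_right {b : B} (hb : IsGood π b) (h l : H) :
    conjOf π (conjOf π b l) h =
      conv (conjOf π b ∘ₗ LinearMap.mulRight k l) (conjOf π 1) h := by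
  rw [conjOf, hb.mulRight_comp, conv_assoc, conjOf_one]; rfl

/-- `h ▹ (l ▹ b) = (h₍₁₎ ▹ 1) (h₍₂₎ l ▹ b)` for `h ▹ b = π(h₍₁₎) b π(S(h₍₂₎))`. -/
theorem conjOf_conjOf_left (hπ : IsPartialRep π) {b : B} (hb : IsGood π b) (h l : H) :
    conjOf π (conjOf π b l) h =
      conv (conjOf π 1) (conjOf π b ∘ₗ LinearMap.mulRight k l) h := by
  have conv_sum : ∀ (s : Finset (H × H)) (F : H × H → (H →ₗ[k] B)),
      conv (epsOf π) (∑ j ∈ s, F j) = ∑ j ∈ s, conv (epsOf π) (F j) := by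
    intro s F
    induction s using Finset.cons_induction with
    | empty => ext; simp [conv]
    | cons a s ha ih => rw [Finset.sum_cons, Finset.sum_cons, conv_add, ih]
  have key : ∀ x : H, conjOf π b l * π x =
      ∑ j ∈ (ℛ k l).index, π ((ℛ k l).left j) * b * π (antipode k ((ℛ k l).right j) * x) := by
    intro x
    have := LinearMap.congr_fun (hπ.conv_mulRight_antipode hb x) l
    rw [conv_apply _ _ (ℛ k l)] at this
    simpa using this.symm
  rw [conjOf_one]
  conv_rhs => rw [conjOf, conv_comp_mulRight, conv_sum, LinearMap.sum_apply]
  have step : ∀ j, conv (epsOf π) (conv ((LinearMap.mulRight k b ∘ₗ π) ∘ₗ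
        LinearMap.mulRight k ((ℛ k l).left j))
      ((π ∘ₗ antipode k) ∘ₗ LinearMap.mulRight k ((ℛ k l).right j))) h =
      ∑ i ∈ (ℛ k h).index, π ((ℛ k h).left i) * (π ((ℛ k l).left j) * b *
        π (antipode k ((ℛ k l).right j) * antipode k ((ℛ k h).right i))) := by
    intro j
    rw [← conv_assoc, LinearMap.comp_assoc, conv_mulRight, hπ.eps_conv_mulRight,
      conv_apply _ _ (ℛ k h)]
    simp [antipode_mul_antidistrib, mul_assoc]
  simp only [step]
  rw [Finset.sum_comm, conjOf, conv_apply _ _ (ℛ k h)]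
  simp [mul_assoc, key, Finset.mul_sum]

end IsPartialRep
end PartialRep

section HPar

variable (k H : Type*) [Field k] [Ring H] [HopfAlgebra k H]

/-- The relations on the tensor algebra of the vector space `H` that make the inclusion of `H` a
partial representation. -/
inductive HParRel : TensorAlgebra k H → TensorAlgebra k H → Prop
  | map_one : HParRel (TensorAlgebra.ι k (1 : H)) 1
  | mul_eps (h l : H) : HParRel
      (TensorAlgebra.ι k h * epsOf (TensorAlgebra.ι k) l)
      (conv (TensorAlgebra.ι k ∘ₗ LinearMap.mulLeft k h) (TensorAlgebra.ι k ∘ₗ antipode k) l)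
  | eps_mul (h l : H) : HParRel
      (epsOf (TensorAlgebra.ι k) h * TensorAlgebra.ι k l)
      (conv (TensorAlgebra.ι k) (TensorAlgebra.ι k ∘ₗ LinearMap.mulRight k l ∘ₗ antipode k) h)

/-- The universal algebra `H_par` for partial representations of `H`. -/
def HPar : Type _ := RingQuot (HParRel k H)

instance : Ring (HPar k H) := inferInstanceAs (Ring (RingQuot (HParRel k H)))

instance : Algebra k (HPar k H) := inferInstanceAs (Algebra k (RingQuot (HParRel k H)))

/-- The quotient map from the tensor algebra to `H_par`. -/
def HPar.mk : TensorAlgebra k H →ₐ[k] HPar k H := RingQuot.mkAlgHom k (HParRel k H)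

/-- The universal partial representation `h ↦ [h]`. -/
def bracket : H →ₗ[k] HPar k H := (HPar.mk k H).toLinearMap ∘ₗ TensorAlgebra.ι k

variable {k H} in
theorem map_conv {B C : Type*} [Ring B] [Algebra k B] [Ring C] [Algebra k C] (φ : B →ₐ[k] C)
    (f g : H →ₗ[k] B) (h : H) :
    φ (conv f g h) = conv (φ.toLinearMap ∘ₗ f) (φ.toLinearMap ∘ₗ g) h := by
  simp [conv_apply _ _ (ℛ k h)]

theorem bracket_isPartialRep : IsPartialRep (bracket k H) where
  map_one := by
    have := RingQuot.mkAlgHom_rel k (HParRel.map_one (k := k) (H := H))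
    exact this.trans (_root_.map_one (HPar.mk k H))
  mul_eps h l := by
    have : HPar.mk k H _ = HPar.mk k H _ :=
      RingQuot.mkAlgHom_rel k (HParRel.mul_eps (k := k) (H := H) h l)
    rwa [_root_.map_mul, epsOf, map_conv, map_conv] at this
  eps_mul h l := by
    have : HPar.mk k H _ = HPar.mk k H _ :=
      RingQuot.mkAlgHom_rel k (HParRel.eps_mul (k := k) (H := H) h l)
    rwa [_root_.map_mul, epsOf, map_conv, map_conv] at this

/-- The elements `ε_h = [h₍₁₎][S(h₍₂₎)]` of `H_par`. -/
def eps : H →ₗ[k] HPar k H := epsOf (bracket k H)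

/-- The subalgebra `A_par` of `H_par` generated by the elements `ε_h`. -/
def APar : Subalgebra k (HPar k H) := Algebra.adjoin k (Set.range (eps k H))

variable {k H} in
theorem APar.good_and_conj_mem {b : HPar k H} (hb : b ∈ APar k H) :
    IsGood (bracket k H) b ∧ ∀ h, conjOf (bracket k H) b h ∈ APar k H := by
  have hπ := bracket_isPartialRep k H
  have eps_mem : ∀ h, epsOf (bracket k H) h ∈ APar k H := fun h =>
    Algebra.subset_adjoin ⟨h, rfl⟩
  have conv_mem : ∀ f g : H →ₗ[k] HPar k H, (∀ h, f h ∈ APar k H) → (∀ h, g h ∈ APar k H) →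
      ∀ h, conv f g h ∈ APar k H := by
    intro f g hf hg h
    rw [conv_apply _ _ (ℛ k h)]
    exact sum_mem fun i _ => mul_mem (hf _) (hg _)
  induction hb using Algebra.adjoin_induction with
  | mem x hx =>
    obtain ⟨l, rfl⟩ := hx
    refine ⟨hπ.isGood_eps l, ?_⟩
    rw [eps, hπ.conjOf_eps]
    exact conv_mem _ _ (fun h => eps_mem _) eps_mem
  | algebraMap r =>
    rw [Algebra.algebraMap_eq_smul_one, IsGood, IsPartialRep.conjOf_smul,
      IsPartialRep.conjOf_one]
    exact ⟨hπ.eps_isCovariant.smul r, fun h => Subalgebra.smul_mem _ (eps_mem h) r⟩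
  | add x y _ _ hx hy =>
    rw [IsGood, IsPartialRep.conjOf_add]
    exact ⟨IsCovariant.add hx.1 hy.1, fun h => add_mem (hx.2 h) (hy.2 h)⟩
  | mul x y _ _ hx hy =>
    refine ⟨hπ.isGood_mul hx.1 hy.1, ?_⟩
    rw [hπ.conjOf_mul hx.1]
    exact conv_mem _ _ hx.2 hy.2

/-- The action `h • a = [h₍₁₎] a [S(h₍₂₎)]` of `H` on `A_par`. -/
def aparAct : H →ₗ[k] Module.End k (APar k H) :=
  LinearMap.mk₂ k (fun h a => ⟨conjOf (bracket k H) a h, (APar.good_and_conj_mem a.2).2 h⟩)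
    (fun _ _ _ => Subtype.ext (map_add _ _ _))
    (fun _ _ _ => Subtype.ext (map_smul _ _ _))
    (fun h _ _ => Subtype.ext (LinearMap.congr_fun (IsPartialRep.conjOf_add _ _ _) h))
    (fun r h _ => Subtype.ext (LinearMap.congr_fun (IsPartialRep.conjOf_smul _ r _) h))

theorem coe_aparAct (h : H) (a : APar k H) :
    (aparAct k H h a : HPar k H) = conjOf (bracket k H) a h := rfl

end HPar

section PartialAction

variable {k H A : Type*} [Field k] [Ring H] [HopfAlgebra k H] [Ring A] [Algebra k A]

/-- Symmetric partial actions of `H` on a unital algebra `A`: `1 • a = a`,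
`h • (a b) = (h₍₁₎ • a)(h₍₂₎ • b)` and
`h • (l • a) = (h₍₁₎ • 1)(h₍₂₎ l • a) = (h₍₁₎ l • a)(h₍₂₎ • 1)`. -/
structure IsPartialAction (ρ : H →ₗ[k] Module.End k A) : Prop where
  one_act : ∀ a, ρ 1 a = a
  act_mul : ∀ h a b, ρ h (a * b) = conv (ρ.flip a) (ρ.flip b) h
  act_act_left : ∀ h l a, ρ h (ρ l a) = conv (ρ.flip 1) (ρ.flip a ∘ₗ LinearMap.mulRight k l) h
  act_act_right : ∀ h l a, ρ h (ρ l a) = conv (ρ.flip a ∘ₗ LinearMap.mulRight k l) (ρ.flip 1) h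

/-- `A` is a (unital, global) `H`-module algebra: `A` is an `H`-module,
`h • (a b) = (h₍₁₎ • a)(h₍₂₎ • b)` and `h • 1 = ε(h) 1`. -/
structure IsModuleAlgebra (ρ : H →ₗ[k] Module.End k A) : Prop where
  one_act : ∀ a, ρ 1 a = a
  mul_act : ∀ h l a, ρ (h * l) a = ρ h (ρ l a)
  act_mul : ∀ h a b, ρ h (a * b) = conv (ρ.flip a) (ρ.flip b) h
  act_one : ∀ h, ρ h 1 = algebraMap k A (counit h)

theorem IsModuleAlgebra.isPartialAction {ρ : H →ₗ[k] Module.End k A} (hρ : IsModuleAlgebra ρ) :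
    IsPartialAction ρ := by
  have h1 : ρ.flip 1 = Algebra.linearMap k A ∘ₗ counit := by
    ext h; simpa using hρ.act_one h
  refine ⟨hρ.one_act, hρ.act_mul, fun h l a => ?_, fun h l a => ?_⟩
  · rw [h1, unit_conv]; simp [hρ.mul_act]
  · rw [h1, conv_unit]; simp [hρ.mul_act]

theorem aparAct_isPartialAction (k H : Type*) [Field k] [Ring H] [HopfAlgebra k H] :
    IsPartialAction (aparAct k H) := by
  have hπ := bracket_isPartialRep k H
  have good := fun a : APar k H => (APar.good_and_conj_mem a.2).1
  have flip_eq : ∀ a : APar k H, (APar k H).val.toLinearMap ∘ₗ (aparAct k H).flip a =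
      conjOf (bracket k H) a := fun a => rfl
  have flip_eq' : ∀ (a : APar k H) (l : H),
      (APar k H).val.toLinearMap ∘ₗ (aparAct k H).flip a ∘ₗ LinearMap.mulRight k l =
        conjOf (bracket k H) a ∘ₗ LinearMap.mulRight k l := fun a l => rfl
  have conv_eq : ∀ (f g : H →ₗ[k] APar k H) (h : H), ((conv f g h : APar k H) : HPar k H) =
      conv ((APar k H).val.toLinearMap ∘ₗ f) ((APar k H).val.toLinearMap ∘ₗ g) h :=
    fun f g h => map_conv (APar k H).val f g h
  refine ⟨fun a => ?_, fun h a b => ?_, fun h l a => ?_, fun h l a => ?_⟩ <;> apply Subtype.ext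
  · exact hπ.conjOf_apply_one _
  · rw [conv_eq, flip_eq, flip_eq]
    exact LinearMap.congr_fun (hπ.conjOf_mul (good a) b) h
  · rw [conv_eq, flip_eq, flip_eq']
    exact hπ.conjOf_conjOf_left (good a) h l
  · rw [conv_eq, flip_eq, flip_eq']
    exact IsPartialRep.conjOf_conjOf_right (good a) h l

end PartialAction

section Diagonal

variable {k H M N P : Type*} [Field k] [Ring H] [HopfAlgebra k H] [AddCommGroup M] [Module k M]
  [AddCommGroup N] [Module k N] [AddCommGroup P] [Module k P]

/-- The diagonal action `h • (m ⊗ x) = h₍₁₎ • m ⊗ h₍₂₎ x` of `H` on `M ⊗ H`. -/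
def diagAct (ρ : H →ₗ[k] Module.End k M) : H →ₗ[k] Module.End k (M ⊗[k] H) :=
  TensorProduct.homTensorHomMap (.id k) M H M H ∘ₗ
    TensorProduct.map ρ (LinearMap.mul k H) ∘ₗ comul

theorem diagAct_tmul {ι : Type*} (ρ : H →ₗ[k] Module.End k M) {h : H} (r : Repr k h ι)
    (m : M) (x : H) :
    diagAct ρ h (m ⊗ₜ x) = ∑ i ∈ r.index, ρ (r.left i) m ⊗ₜ[k] (r.right i * x) := by
  simp only [diagAct, LinearMap.comp_apply, ← r.eq, map_sum, TensorProduct.map_tmul,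
    TensorProduct.homTensorHomMap_apply, LinearMap.sum_apply, LinearMap.mul_apply']

theorem diagAct_mul_tmul (ρ : H →ₗ[k] Module.End k M) (h l : H) (m : M) (x : H) :
    diagAct ρ (h * l) (m ⊗ₜ x) = ∑ i ∈ (ℛ k h).index, ∑ j ∈ (ℛ k l).index,
      ρ ((ℛ k h).left i * (ℛ k l).left j) m ⊗ₜ[k]
        ((ℛ k h).right i * (ℛ k l).right j * x) := by
  rw [diagAct_tmul _ ((ℛ k h).mul (ℛ k l)), Coalgebra.Repr.mul]
  simp [Finset.sum_product]

/-- The space `{M, N}` of maps `M ⊗ H → N` that commute with the partial actions of `H`, where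
`H` acts diagonally on `M ⊗ H`. -/
def homObj (ρM : H →ₗ[k] Module.End k M) (ρN : H →ₗ[k] Module.End k N) :
    Submodule k (M ⊗[k] H →ₗ[k] N) where
  carrier := {f | ∀ h z, f (diagAct ρM h z) = ρN h (f z)}
  add_mem' hf hg h z := by simp [hf h z, hg h z]
  zero_mem' h z := by simp
  smul_mem' c f hf h z := by simp [hf h z]

theorem diagAct_lTensor_mulRight (ρ : H →ₗ[k] Module.End k M) (h l : H) (z : M ⊗[k] H) :
    LinearMap.lTensor M (LinearMap.mulRight k l) (diagAct ρ h z) =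
      diagAct ρ h (LinearMap.lTensor M (LinearMap.mulRight k l) z) := by
  induction z with
  | zero => simp
  | add a b ha hb => simp only [map_add, ha, hb]
  | tmul m x => simp [diagAct_tmul _ (ℛ k h), mul_assoc]

/-- The action `(h ⇀ f)(m ⊗ x) = f(m ⊗ x h)` of `H` on `{M, N}`. -/
def homAct (ρM : H →ₗ[k] Module.End k M) (ρN : H →ₗ[k] Module.End k N) :
    H →ₗ[k] Module.End k (homObj ρM ρN) :=
  LinearMap.mk₂ k
    (fun h f => ⟨f.1 ∘ₗ LinearMap.lTensor M (LinearMap.mulRight k h), fun l z => by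
      rw [LinearMap.comp_apply, diagAct_lTensor_mulRight, f.2]; rfl⟩)
    (fun h l f => by
      apply Subtype.ext; ext m x; simp [mul_add, TensorProduct.tmul_add])
    (fun c h f => by apply Subtype.ext; ext m x; simp)
    (fun h f g => by apply Subtype.ext; ext m x; simp)
    (fun c h f => by apply Subtype.ext; ext m x; simp)

@[simp]
theorem homAct_apply_tmul (ρM : H →ₗ[k] Module.End k M) (ρN : H →ₗ[k] Module.End k N)
    (h : H) (f : homObj ρM ρN) (m : M) (x : H) :
    (homAct ρM ρN h f).1 (m ⊗ₜ x) = f.1 (m ⊗ₜ (x * h)) := rfl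

/-- The map `m ⊗ h ↦ f(m ⊗ h₍₁₎) ⊗ h₍₂₎`. -/
def coext (f : M ⊗[k] H →ₗ[k] N) : M ⊗[k] H →ₗ[k] N ⊗[k] H :=
  LinearMap.rTensor H f ∘ₗ (TensorProduct.assoc k M H H).symm.toLinearMap ∘ₗ
    LinearMap.lTensor M comul

theorem coext_tmul {ι : Type*} (f : M ⊗[k] H →ₗ[k] N) {h : H} (r : Repr k h ι) (m : M) :
    coext f (m ⊗ₜ h) = ∑ i ∈ r.index, f (m ⊗ₜ r.left i) ⊗ₜ[k] r.right i := by
  simp [coext, ← r.eq, TensorProduct.tmul_sum]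

theorem coext_tmul_mul (f : M ⊗[k] H →ₗ[k] N) (h l : H) (m : M) :
    coext f (m ⊗ₜ (h * l)) = ∑ i ∈ (ℛ k h).index, ∑ j ∈ (ℛ k l).index,
      f (m ⊗ₜ ((ℛ k h).left i * (ℛ k l).left j)) ⊗ₜ[k]
        ((ℛ k h).right i * (ℛ k l).right j) := by
  rw [coext_tmul _ ((ℛ k h).mul (ℛ k l)), Coalgebra.Repr.mul]
  simp [Finset.sum_product]

theorem coext_add (f g : M ⊗[k] H →ₗ[k] N) : coext (f + g) = coext f + coext g := by
  simp [coext, LinearMap.rTensor_add, LinearMap.add_comp]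

theorem coext_smul (c : k) (f : M ⊗[k] H →ₗ[k] N) : coext (c • f) = c • coext f := by
  simp [coext, LinearMap.rTensor_smul, LinearMap.smul_comp]

/-- `coext` is compatible with the composition `g ∘ coext f`. -/
theorem coext_comp_coext (f : M ⊗[k] H →ₗ[k] N) (g : N ⊗[k] H →ₗ[k] P) :
    coext (g ∘ₗ coext f) = coext g ∘ₗ coext f := by
  ext m h
  have := sum_coassoc (((TensorProduct.mk k N H).compr₂ g ∘ₗ
    f ∘ₗ TensorProduct.mk k M H m).compr₂ (TensorProduct.mk k P H)) h
  simp only [LinearMap.compr₂_apply, LinearMap.comp_apply, TensorProduct.mk_apply] at this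
  simp only [TensorProduct.AlgebraTensorModule.curry_apply, TensorProduct.curry_apply,
    LinearMap.coe_restrictScalars, LinearMap.comp_apply]
  rw [coext_tmul _ (ℛ k h), coext_tmul _ (ℛ k h)]
  simp only [LinearMap.comp_apply, coext_tmul _ (ℛ k _), map_sum, TensorProduct.sum_tmul]
  exact this

theorem coext_diagAct {ρM : H →ₗ[k] Module.End k M} {ρN : H →ₗ[k] Module.End k N}
    {f : M ⊗[k] H →ₗ[k] N} (hf : f ∈ homObj ρM ρN) (h : H) (z : M ⊗[k] H) :
    coext f (diagAct ρM h z) = diagAct ρN h (coext f z) := by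
  induction z with
  | zero => simp
  | add a b ha hb => simp only [map_add, ha, hb]
  | tmul m x =>
    rw [diagAct_tmul _ (ℛ k h), coext_tmul _ (ℛ k x)]
    have hf' : ∀ h z, ρN h (f z) = f (diagAct ρM h z) := fun h z => (hf h z).symm
    simp only [map_sum, coext_tmul_mul, diagAct_tmul _ (ℛ k h), hf', diagAct_tmul _ (ℛ k _)]
    simp only [TensorProduct.sum_tmul]
    rw [Finset.sum_congr rfl fun i _ => Finset.sum_comm, Finset.sum_comm]
    refine Finset.sum_congr rfl fun j _ => ?_
    let Ψ : H →ₗ[k] H →ₗ[k] H →ₗ[k] N ⊗[k] H :=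
      ((((TensorProduct.mk k M H).compl₂ (LinearMap.mulRight k ((ℛ k x).left j))) ∘ₗ
        ρM.flip m).compr₂ f).compr₂
          ((TensorProduct.mk k N H).compl₂ (LinearMap.mulRight k ((ℛ k x).right j)))
    exact (sum_coassoc Ψ h).symm

/-- The composition `(f ∘ g)(m ⊗ h) = g(f(m ⊗ h₍₁₎) ⊗ h₍₂₎)` of `f ∈ {M, N}` and
`g ∈ {N, P}`. -/
def homComp {ρM : H →ₗ[k] Module.End k M} {ρN : H →ₗ[k] Module.End k N}
    {ρP : H →ₗ[k] Module.End k P} (f : homObj ρM ρN) (g : homObj ρN ρP) : homObj ρM ρP :=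
  ⟨g.1 ∘ₗ coext f.1, fun h z => by
    rw [LinearMap.comp_apply, coext_diagAct f.2, g.2]; rfl⟩

/-- The identity `m ⊗ h ↦ ε(h) m` in `{M, M}`. -/
def homId (ρ : H →ₗ[k] Module.End k M) : homObj ρ ρ :=
  ⟨(TensorProduct.rid k M).toLinearMap ∘ₗ LinearMap.lTensor M counit, fun h z => by
    induction z with
    | zero => simp
    | add a b ha hb => simp only [map_add] at ha hb ⊢; rw [ha, hb]
    | tmul m x =>
      rw [diagAct_tmul _ (ℛ k h)]
      have := sum_counit_right (ρ.flip m) h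
      simp only [LinearMap.flip_apply] at this
      simp [← this, Finset.smul_sum, mul_smul, smul_comm _ (counit (R := k) x)]⟩

@[simp]
theorem homId_apply_tmul (ρ : H →ₗ[k] Module.End k M) (m : M) (x : H) :
    (homId ρ).1 (m ⊗ₜ x) = counit (R := k) x • m := by
  simp [homId]

theorem coext_homId (ρ : H →ₗ[k] Module.End k M) : coext (homId ρ).1 = LinearMap.id := by
  ext m h
  have := sum_counit_left (TensorProduct.mk k M H m) h
  simpa [coext_tmul _ (ℛ k h), TensorProduct.smul_tmul'] using this

theorem homId_comp_coext (f : M ⊗[k] H →ₗ[k] N) (ρ : H →ₗ[k] Module.End k N) :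
    (homId ρ).1 ∘ₗ coext f = f := by
  ext m h
  have := sum_counit_right (f ∘ₗ TensorProduct.mk k M H m) h
  simpa [coext_tmul _ (ℛ k h)] using this

/-- The algebra `{M, M}` under composition. -/
def EndObj (ρ : H →ₗ[k] Module.End k M) : Type _ := homObj ρ ρ

variable (ρ : H →ₗ[k] Module.End k M)

instance : AddCommGroup (EndObj ρ) := inferInstanceAs (AddCommGroup (homObj ρ ρ))

instance : Module k (EndObj ρ) := inferInstanceAs (Module k (homObj ρ ρ))

/-- The underlying linear map of an element of `{M, M}`. -/
def EndObj.toHom : EndObj ρ →ₗ[k] M ⊗[k] H →ₗ[k] M := (homObj ρ ρ).subtype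

instance : Ring (EndObj ρ) where
  toAddCommGroup := inferInstance
  mul f g := homComp f g
  one := homId ρ
  mul_assoc f g h := by
    apply Subtype.ext
    change h.1 ∘ₗ coext (g.1 ∘ₗ coext f.1) = (h.1 ∘ₗ coext g.1) ∘ₗ coext f.1
    rw [coext_comp_coext, LinearMap.comp_assoc]
  one_mul f := by
    apply Subtype.ext
    change f.1 ∘ₗ coext (homId ρ).1 = f.1
    rw [coext_homId, LinearMap.comp_id]
  mul_one f := Subtype.ext (homId_comp_coext f.1 ρ)
  left_distrib f g h := Subtype.ext (LinearMap.add_comp _ _ _)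
  right_distrib f g h := by
    apply Subtype.ext
    change h.1 ∘ₗ coext (f.1 + g.1) = h.1 ∘ₗ coext f.1 + h.1 ∘ₗ coext g.1
    rw [coext_add, LinearMap.comp_add]
  zero_mul f := by
    apply Subtype.ext
    change f.1 ∘ₗ coext (0 : M ⊗[k] H →ₗ[k] M) = 0
    simp [coext]
  mul_zero f := Subtype.ext (LinearMap.zero_comp _)

instance : Algebra k (EndObj ρ) :=
  Algebra.ofModule
    (fun c f g => by
      apply Subtype.ext
      change g.1 ∘ₗ coext (c • f.1) = c • (g.1 ∘ₗ coext f.1)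
      rw [coext_smul, LinearMap.comp_smul])
    (fun c f g => by
      apply Subtype.ext
      change (c • g.1) ∘ₗ coext f.1 = c • (g.1 ∘ₗ coext f.1)
      rw [LinearMap.smul_comp])

/-- The action `(h ⇀ f)(m ⊗ x) = f(m ⊗ x h)` of `H` on the algebra `{M, M}`. -/
def endAct : H →ₗ[k] Module.End k (EndObj ρ) := homAct ρ ρ

theorem endAct_isModuleAlgebra : IsModuleAlgebra (endAct ρ) where
  one_act f := by
    apply Subtype.ext; ext m x
    change f.1 (m ⊗ₜ (x * 1)) = _
    rw [mul_one]; rfl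
  mul_act h l f := by
    apply Subtype.ext; ext m x
    change f.1 (m ⊗ₜ (x * (h * l))) = f.1 (m ⊗ₜ (x * h * l))
    rw [mul_assoc]
  act_mul h f g := by
    apply Subtype.ext; ext m x
    rw [conv_apply _ _ (ℛ k h)]
    change EndObj.toHom ρ g (coext (EndObj.toHom ρ f) (m ⊗ₜ (x * h))) =
      EndObj.toHom ρ (∑ i ∈ _, _) (m ⊗ₜ x)
    rw [map_sum, LinearMap.sum_apply, coext_tmul_mul, map_sum, Finset.sum_congr rfl fun i _ =>
      map_sum _ _ _, Finset.sum_comm]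
    refine Finset.sum_congr rfl fun i _ => ?_
    change _ = EndObj.toHom ρ (endAct ρ ((ℛ k h).right i) g)
      (coext (EndObj.toHom ρ (endAct ρ ((ℛ k h).left i) f)) (m ⊗ₜ x))
    rw [coext_tmul _ (ℛ k x), map_sum]
    rfl
  act_one h := by
    apply Subtype.ext; ext m x
    rw [Algebra.algebraMap_eq_smul_one]
    change (homId ρ).1 (m ⊗ₜ (x * h)) = counit (R := k) h • (homId ρ).1 (m ⊗ₜ x)
    rw [homId_apply_tmul, homId_apply_tmul, Bialgebra.counit_mul, mul_comm, mul_smul]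

end Diagonal

section Smash

variable {k H A : Type*} [Field k] [Ring H] [HopfAlgebra k H] [Ring A] [Algebra k A]

/-- The multiplication `(a ⊗ h)(b ⊗ l) = a (h₍₁₎ • b) ⊗ h₍₂₎ l` on `A ⊗ H`. -/
def smashMul (ρ : H →ₗ[k] Module.End k A) : A ⊗[k] H →ₗ[k] A ⊗[k] H →ₗ[k] A ⊗[k] H :=
  TensorProduct.lift (LinearMap.mk₂ k
    (fun a h => LinearMap.rTensor H (LinearMap.mulLeft k a) ∘ₗ diagAct ρ h)
    (fun a b h => by
      ext; simp [diagAct_tmul _ (ℛ k h), add_mul, TensorProduct.add_tmul, Finset.sum_add_distrib])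
    (fun c a h => by
      ext; simp [diagAct_tmul _ (ℛ k h), TensorProduct.smul_tmul', Finset.smul_sum])
    (fun a h l => by rw [map_add]; exact LinearMap.comp_add _ _ _)
    (fun c a h => by rw [map_smul]; exact LinearMap.comp_smul _ _ _))

theorem smashMul_tmul (ρ : H →ₗ[k] Module.End k A) (a : A) (h : H) (z : A ⊗[k] H) :
    smashMul ρ (a ⊗ₜ h) z = LinearMap.rTensor H (LinearMap.mulLeft k a) (diagAct ρ h z) := rfl

theorem smashMul_tmul_tmul {ι : Type*} (ρ : H →ₗ[k] Module.End k A) (a b : A) {h : H}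
    (r : Repr k h ι) (l : H) :
    smashMul ρ (a ⊗ₜ h) (b ⊗ₜ l) =
      ∑ i ∈ r.index, (a * ρ (r.left i) b) ⊗ₜ[k] (r.right i * l) := by
  simp [smashMul_tmul, diagAct_tmul _ r]

theorem IsPartialAction.smashMul_assoc {ρ : H →ₗ[k] Module.End k A} (hρ : IsPartialAction ρ)
    (x y z : A ⊗[k] H) : smashMul ρ (smashMul ρ x y) z = smashMul ρ x (smashMul ρ y z) := by
  induction x with
  | zero => simp
  | add x x' hx hx' => simp only [map_add, LinearMap.add_apply, hx, hx']
  | tmul a h =>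
  induction y with
  | zero => simp
  | add y y' hy hy' => simp only [map_add, LinearMap.add_apply, hy, hy']
  | tmul b g =>
  induction z with
  | zero => simp
  | add z z' hz hz' => simp only [map_add, hz, hz']
  | tmul c t =>
    -- both sides are `a (h₍₁₎ • b) (h₍₂₎ g₍₁₎ • c) ⊗ h₍₃₎ g₍₂₎ t`
    have hb : ∀ l y : H, ρ l (b * ρ y c) =
        ∑ i ∈ (ℛ k l).index, ρ ((ℛ k l).left i) b * ρ ((ℛ k l).right i * y) c := by
      intro l y
      have h1 : ∀ l, ρ l b = conv (ρ.flip b) (ρ.flip 1) l := fun l => by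
        rw [← hρ.act_mul, mul_one]
      have h2 : ρ.flip (ρ y c) = conv (ρ.flip 1) (ρ.flip c ∘ₗ LinearMap.mulRight k y) := by
        ext l; exact hρ.act_act_left l y c
      have h3 : ρ.flip b = conv (ρ.flip b) (ρ.flip 1) := by ext l; exact h1 l
      rw [hρ.act_mul, h2, ← conv_assoc, ← h3, conv_apply _ _ (ℛ k l)]
      rfl
    rw [smashMul_tmul_tmul _ _ _ (ℛ k h), smashMul_tmul_tmul _ _ _ (ℛ k g)]
    simp only [map_sum, LinearMap.sum_apply, smashMul_tmul, diagAct_mul_tmul,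
      diagAct_tmul _ (ℛ k h), LinearMap.rTensor_tmul, LinearMap.mulLeft_apply, hb]
    simp only [TensorProduct.sum_tmul]
    rw [Finset.sum_congr rfl fun i _ => Finset.sum_comm, Finset.sum_comm]
    refine Finset.sum_congr rfl fun j _ => ?_
    let Ψ : H →ₗ[k] H →ₗ[k] H →ₗ[k] A ⊗[k] H :=
      ((((LinearMap.mul k A).compl₂ (ρ.flip c ∘ₗ LinearMap.mulRight k ((ℛ k g).left j))) ∘ₗ
        LinearMap.mulLeft k a ∘ₗ ρ.flip b)).compr₂
          ((TensorProduct.mk k A H).compl₂ (LinearMap.mulRight k ((ℛ k g).right j * t)))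
    have := sum_coassoc Ψ h
    simpa [Ψ, mul_assoc] using this.symm

theorem IsPartialAction.one_smashMul {ρ : H →ₗ[k] Module.End k A} (hρ : IsPartialAction ρ)
    (z : A ⊗[k] H) : smashMul ρ (1 ⊗ₜ 1) z = z := by
  induction z with
  | zero => simp
  | add z z' hz hz' => rw [map_add, hz, hz']
  | tmul a h => simp [smashMul_tmul, diagAct, Algebra.TensorProduct.one_def, hρ.one_act,
      TensorProduct.homTensorHomMap]

/-- The smash product `A # H` of an `H`-module algebra: the vector space `A ⊗ H` with
multiplication `smashMul`. -/
def SmashProduct (ρ : H →ₗ[k] Module.End k A) (_hρ : IsModuleAlgebra ρ) : Type _ := A ⊗[k] H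

section Global

variable {ρ : H →ₗ[k] Module.End k A} (hρ : IsModuleAlgebra ρ)

instance : AddCommGroup (SmashProduct ρ hρ) := inferInstanceAs (AddCommGroup (A ⊗[k] H))

instance : Module k (SmashProduct ρ hρ) := inferInstanceAs (Module k (A ⊗[k] H))

theorem IsModuleAlgebra.smashMul_one {ρ : H →ₗ[k] Module.End k A} (hρ : IsModuleAlgebra ρ)
    (z : A ⊗[k] H) : smashMul ρ z (1 ⊗ₜ 1) = z := by
  induction z with
  | zero => simp
  | add z z' hz hz' => rw [map_add, LinearMap.add_apply, hz, hz']
  | tmul a h =>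
    have := sum_counit_left (TensorProduct.mk k A H a) h
    simpa [smashMul_tmul_tmul _ _ _ (ℛ k h), hρ.act_one, ← Algebra.commutes,
      ← Algebra.smul_def, TensorProduct.smul_tmul'] using this

instance : Ring (SmashProduct ρ hρ) where
  toAddCommGroup := inferInstance
  mul x y := smashMul ρ x y
  one := ((1 : A) ⊗ₜ[k] (1 : H) : A ⊗[k] H)
  mul_assoc := hρ.isPartialAction.smashMul_assoc
  one_mul := hρ.isPartialAction.one_smashMul
  mul_one := hρ.smashMul_one
  left_distrib x _ _ := map_add (smashMul ρ x) _ _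
  right_distrib x y z := LinearMap.congr_fun (map_add (smashMul ρ) x y) z
  zero_mul x := LinearMap.congr_fun (map_zero (smashMul ρ)) x
  mul_zero x := map_zero (smashMul ρ x)

instance : Algebra k (SmashProduct ρ hρ) :=
  Algebra.ofModule
    (fun c x y => LinearMap.congr_fun (map_smul (smashMul ρ) c x) y)
    (fun c x y => map_smul (smashMul ρ x) c y)

end Global

/-- The partial smash product of a partial action of `H` on `A`: the subspace
`(A ⊗ H)(1 ⊗ 1)` of `A ⊗ H`, with multiplication `smashMul` and unit `1 ⊗ 1`. -/
def PartialSmashProduct (ρ : H →ₗ[k] Module.End k A) (_hρ : IsPartialAction ρ) : Type _ :=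
  LinearMap.range ((smashMul ρ).flip (1 ⊗ₜ 1))

section Partial

variable {ρ : H →ₗ[k] Module.End k A} (hρ : IsPartialAction ρ)

instance : AddCommGroup (PartialSmashProduct ρ hρ) :=
  inferInstanceAs (AddCommGroup (LinearMap.range ((smashMul ρ).flip (1 ⊗ₜ 1))))

instance : Module k (PartialSmashProduct ρ hρ) :=
  inferInstanceAs (Module k (LinearMap.range ((smashMul ρ).flip (1 ⊗ₜ 1))))

instance : Ring (PartialSmashProduct ρ hρ) where
  toAddCommGroup := inferInstance
  mul x y := ⟨smashMul ρ x.1 y.1, by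
    obtain ⟨y, z, rfl⟩ := y
    exact ⟨smashMul ρ x.1 z, hρ.smashMul_assoc _ _ _⟩⟩
  one := ⟨1 ⊗ₜ 1, 1 ⊗ₜ 1, hρ.one_smashMul _⟩
  mul_assoc x y z := Subtype.ext (hρ.smashMul_assoc x.1 y.1 z.1)
  one_mul x := Subtype.ext (hρ.one_smashMul x.1)
  mul_one x := by
    obtain ⟨x, z, rfl⟩ := x
    apply Subtype.ext
    change smashMul ρ (smashMul ρ z (1 ⊗ₜ 1)) (1 ⊗ₜ 1) = smashMul ρ z (1 ⊗ₜ 1)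
    rw [hρ.smashMul_assoc, hρ.one_smashMul]
  left_distrib x _ _ := Subtype.ext (map_add (smashMul ρ x.1) _ _)
  right_distrib x y z := Subtype.ext (LinearMap.congr_fun (map_add (smashMul ρ) x.1 y.1) z.1)
  zero_mul x := Subtype.ext (LinearMap.congr_fun (map_zero (smashMul ρ)) x.1)
  mul_zero x := Subtype.ext (map_zero (smashMul ρ x.1))

instance : Algebra k (PartialSmashProduct ρ hρ) :=
  Algebra.ofModule
    (fun c x y => Subtype.ext (LinearMap.congr_fun (map_smul (smashMul ρ) c x.1) y.1))
    (fun c x y => Subtype.ext (map_smul (smashMul ρ x.1) c y.1))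

/-- The element `a # h = (a ⊗ h)(1 ⊗ 1) = a (h₍₁₎ • 1) ⊗ h₍₂₎` of the partial smash product. -/
def PartialSmashProduct.mk (a : A) (h : H) : PartialSmashProduct ρ hρ :=
  ⟨smashMul ρ (a ⊗ₜ h) (1 ⊗ₜ 1), a ⊗ₜ h, rfl⟩

end Partial

end Smash

section Main

variable (k H : Type*) [Field k] [Ring H] [HopfAlgebra k H]

/-- The algebra `{A_par, A_par}`. -/
abbrev EndAPar : Type _ := EndObj (aparAct k H)

/-- The linear map `A_par ⊗ H → A_par`, `b ⊗ h ↦ b (h • a)`, as a function of `a`. -/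
def thetaLin : APar k H →ₗ[k] APar k H ⊗[k] H →ₗ[k] APar k H :=
  LinearMap.mk₂ k
    (fun a z => TensorProduct.lift
      ((LinearMap.mul k (APar k H)).compl₂ ((aparAct k H).flip a)) z)
    (fun a b z => by
      rw [← LinearMap.add_apply]
      exact LinearMap.congr_fun (TensorProduct.ext' fun _ _ => by simp [mul_add]) z)
    (fun c a z => by
      rw [← LinearMap.smul_apply]
      exact LinearMap.congr_fun (TensorProduct.ext' fun _ _ => by simp) z)
    (fun a x y => map_add _ x y)
    (fun c a x => map_smul _ c x)

theorem thetaLin_tmul (a b : APar k H) (h : H) :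
    thetaLin k H a (b ⊗ₜ h) = b * aparAct k H h a := rfl

theorem thetaLin_mem (a : APar k H) :
    thetaLin k H a ∈ homObj (aparAct k H) (aparAct k H) := by
  intro h z
  have hρ := aparAct_isPartialAction k H
  induction z with
  | zero => simp
  | add x y hx hy => simp only [map_add, hx, hy]
  | tmul b x =>
    have h1 : (aparAct k H).flip (aparAct k H x a) = conv ((aparAct k H).flip 1)
        ((aparAct k H).flip a ∘ₗ LinearMap.mulRight k x) := by
      ext1 l; exact hρ.act_act_left l x a
    have h2 : conv ((aparAct k H).flip b) ((aparAct k H).flip 1) = (aparAct k H).flip b := by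
      ext1 l; rw [← hρ.act_mul, mul_one]; rfl
    rw [diagAct_tmul _ (ℛ k h)]
    simp only [map_sum, thetaLin_tmul]
    rw [hρ.act_mul, h1, ← conv_assoc, h2, conv_apply _ _ (ℛ k h)]
    rfl

/-- The map `θ : A_par → {A_par, A_par}`, `θ(a)(b ⊗ h) = b (h • a)`. -/
def theta : APar k H →ₗ[k] EndAPar k H :=
  (thetaLin k H).codRestrict (homObj (aparAct k H) (aparAct k H)) (thetaLin_mem k H)

/-- The algebra `H_glob = {A_par, A_par} # H`. -/
abbrev HGlob : Type _ := SmashProduct (endAct (aparAct k H)) (endAct_isModuleAlgebra (aparAct k H))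

/-- The partial smash product of `A_par` and `H`. -/
abbrev APartialSmash : Type _ := PartialSmashProduct (aparAct k H) (aparAct_isPartialAction k H)

/-- The globalization `({A_par, A_par}, θ)` of `A_par` is proper, that is, `{A_par, A_par}` is
generated by `θ(A_par)` as an `H`-module. -/
def IsProperGlobalization : Prop :=
  Submodule.span k {f | ∃ (h : H) (a : APar k H), endAct (aparAct k H) h (theta k H a) = f} = ⊤

end Main
end
end PartialHopf

/-!
The theorem has two parts, and both come from one embedding.

*The isomorphism.* The linear map `a ⊗ h ↦ a [h]` from `A_par ⊗ H` to `H_par` is multiplicative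
because `(h₍₁₎ • b) [h₍₂₎ l] = [h] b [l]` (`mulBracket_smashMul`). Its restriction to the partial
smash product is inverted by the homomorphism that the universal property of `H_par` attaches to
`h ↦ 1 # h`: for every symmetric partial action this map is a partial representation
(`unitMk_isPartialRep`), and `(1 # h₍₁₎)(1 # S(h₍₂₎)) = (h • 1) # 1` shows that the homomorphism
sends `a ∈ A_par` to `a # 1`.

*The Morita equivalence.* The elements of `{A_par, A_par}` are `A_par`-linear in the first tensor
factor: the algebra `A_par` is generated by the elements `h • 1`, and in the diagonal action on
`A_par ⊗ H` the operator of `h₍₁₎` after that of `S(h₍₂₎)` is multiplication of the first factor by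
`h • 1` (`IsPartialAction.conv_diagAct_antipode`, which rests on `Δ(S h) = S(h₍₂₎) ⊗ S(h₍₁₎)`).
Hence `θ(a) ∘ f = θ(f(a ⊗ 1))` (`theta_mul`). It follows that `θ ⊗ H` is multiplicative, and that it
identifies the partial smash product, hence `H_par`, with the corner `e H_glob e` of the idempotent
`e = θ(1) # 1` (`hparToHGlob_range`). Properness is what makes this idempotent full: the elements
`(h ⇀ θ(a)) # 1 = (1 # h₍₁₎)(θ(a) # 1)(1 # S(h₍₂₎))` lie in the ideal generated by `e`, and they
span `{A_par, A_par} # 1`, which contains the unit (`hparToHGlob_full`). A ring is Morita equivalent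
to each of its full corners (`FullCorner.isMoritaEquivalent`): the functor `M ↦ eM` is fully
faithful, and every `eRe`-module `N` is of the form `e Hom(eR, N)`.
-/

/-! ### Morita equivalence from a full idempotent -/

namespace FullCorner

open CategoryTheory

universe u

variable {k : Type*} {R C : Type u} [CommSemiring k] [Ring R] [Algebra k R] [Ring C] [Algebra k C]
  (j : C →ₙₐ[k] R)

/-- The part `eM` of an `R`-module `M` for the idempotent `e = j 1`. -/
def corner (M : Type*) [AddCommGroup M] [Module R M] : AddSubgroup M where
  carrier := {m | j 1 • m = m}
  add_mem' {a b} ha hb := by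
    simp only [Set.mem_ofPred_eq] at *
    rw [smul_add, ha, hb]
  zero_mem' := smul_zero _
  neg_mem' {a} ha := by
    simp only [Set.mem_ofPred_eq] at *
    rw [smul_neg, ha]

variable {j}

theorem one_mul_map (c : C) : j 1 * j c = j c := by rw [← map_mul, one_mul]

theorem map_mul_one (c : C) : j c * j 1 = j c := by rw [← map_mul, mul_one]

theorem smul_mem_corner {M : Type*} [AddCommGroup M] [Module R M] (c : C) (m : M) :
    j c • m ∈ corner j M := by
  change j 1 • j c • m = j c • m
  rw [smul_smul, one_mul_map]

instance (M : Type*) [AddCommGroup M] [Module R M] : Module C (corner j M) where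
  smul c m := ⟨j c • (m : M), smul_mem_corner c _⟩
  one_smul m := Subtype.ext m.2
  mul_smul c d m := Subtype.ext (by
    change j (c * d) • (m : M) = j c • j d • (m : M)
    rw [map_mul, mul_smul])
  smul_zero c := Subtype.ext (smul_zero (j c))
  smul_add c m n := Subtype.ext (smul_add (j c) (m : M) n)
  add_smul c d m := Subtype.ext (by
    change j (c + d) • (m : M) = j c • (m : M) + j d • (m : M)
    rw [map_add, add_smul])
  zero_smul m := Subtype.ext (by
    change j 0 • (m : M) = 0
    rw [map_zero, zero_smul])

variable (j) in
/-- The projection `m ↦ e m` of `M` onto `eM`. -/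
def toCorner (M : Type*) [AddCommGroup M] [Module R M] : M →+ corner j M where
  toFun m := ⟨j 1 • m, smul_mem_corner 1 m⟩
  map_zero' := Subtype.ext (smul_zero _)
  map_add' m n := Subtype.ext (smul_add _ m n)

variable (j) in
/-- The functor `M ↦ eM` from `R`-modules to `C`-modules, where `e = j 1`. -/
def functor : ModuleCat.{u} R ⥤ ModuleCat.{u} C where
  obj M := ModuleCat.of C (corner j M)
  map {M N} f := ModuleCat.ofHom
    { toFun := fun m => ⟨f.hom m.1, by
        change j 1 • f.hom m.1 = f.hom m.1
        rw [← map_smul, m.2]⟩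
      map_add' := fun m n => Subtype.ext (map_add f.hom m.1 n.1)
      map_smul' := fun c m => Subtype.ext (map_smul f.hom (j c) m.1) }

/-- An expression `1 = ∑ xᵢ e yᵢ` of the fullness of `e = j 1`. -/
theorem exists_sum_eq_one
    (hfull : Submodule.span k (Set.range fun p : R × R => p.1 * j 1 * p.2) = ⊤) :
    ∃ (s : Finset (R × R)) (x y : R × R → R), ∑ i ∈ s, x i * j 1 * y i = 1 := by
  have h1 : (1 : R) ∈ Submodule.span k (Set.range fun p : R × R => p.1 * j 1 * p.2) :=
    hfull ▸ Submodule.mem_top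
  obtain ⟨c, hc⟩ := Finsupp.mem_span_range_iff_exists_finsupp.1 h1
  exact ⟨c.support, fun i => c i • i.1, fun i => i.2, by simpa [Finsupp.sum] using hc⟩

theorem faithful {s : Finset (R × R)} {x y : R × R → R}
    (hs : ∑ i ∈ s, x i * j 1 * y i = 1) : (functor j).Faithful where
  map_injective {M N f g} hfg := by
    ext m
    have key : ∀ r : R, f.hom (j 1 • r • m) = g.hom (j 1 • r • m) := fun r => by
      have := congrArg (fun φ => ((ModuleCat.Hom.hom φ) (⟨j 1 • r • m, smul_mem_corner 1 _⟩ :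
        corner j M) : corner j N).1) hfg
      exact this
    rw [← one_smul R m, ← hs]
    simp only [Finset.sum_smul, mul_smul, map_sum]
    exact Finset.sum_congr rfl fun i _ => by
      rw [map_smul f.hom, map_smul g.hom, key]

theorem full {s : Finset (R × R)} {x y : R × R → R}
    (hrange : ∀ r : R, ∃ c, j c = j 1 * r * j 1)
    (hs : ∑ i ∈ s, x i * j 1 * y i = 1) : (functor j).Full where
  map_surjective {M N} g := by
    let g' : corner j M →ₗ[C] corner j N := g.hom
    -- `g` commutes with `e r e` for every `r`, since `e r e` acts through `C`
    have hg : ∀ (r : R) (m : corner j M),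
        g' (toCorner j M (r • m.1)) = toCorner j N (r • (g' m).1) := by
      intro r m
      obtain ⟨c, hc⟩ := hrange r
      have h1 : toCorner j M (r • m.1) = c • m := Subtype.ext (by
        change j 1 • r • m.1 = j c • m.1
        rw [hc, mul_smul, mul_smul]
        exact congrArg (fun z => j 1 • r • z) m.2.symm)
      have h2 : toCorner j N (r • (g' m).1) = c • g' m := Subtype.ext (by
        change j 1 • r • (g' m).1 = j c • (g' m).1
        rw [hc, mul_smul, mul_smul]
        exact congrArg (fun z => j 1 • r • z) (g' m).2.symm)
      rw [h1, h2, map_smul]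
    have expand : ∀ {L : ModuleCat.{u} R} (m : L), m = ∑ i ∈ s, x i • j 1 • y i • m := by
      intro L m
      conv_lhs => rw [← one_smul R m, ← hs]
      simp only [Finset.sum_smul, mul_smul]
    -- linearity over `R` forces this value, since `m = ∑ xᵢ e yᵢ m`
    let f : M →+ N :=
      { toFun := fun m => ∑ i ∈ s, x i • (g' (toCorner j M (y i • m))).1
        map_zero' := by simp
        map_add' := fun m n => by simp [Finset.sum_add_distrib] }
    have hf : ∀ (r : R) (m : M), f (r • m) = r • f m := by
      intro r m
      have h1 : ∀ i, (g' (toCorner j M (y i • r • m))).1 =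
          j 1 • y i • r • ∑ l ∈ s, x l • (g' (toCorner j M (y l • m))).1 := by
        intro i
        conv_lhs => rw [expand m]
        simp only [Finset.smul_sum, map_sum, AddSubgroup.val_finsetSum]
        refine Finset.sum_congr rfl fun l _ => ?_
        have := hg (y i * r * x l) (toCorner j M (y l • m))
        rw [mul_smul, mul_smul] at this
        refine (congrArg Subtype.val this).trans ?_
        change j 1 • _ = _
        rw [mul_smul, mul_smul]
      change ∑ i ∈ s, x i • (g' (toCorner j M (y i • r • m))).1 = _
      simp only [h1]
      exact (expand (L := N) (r • f m)).symm
    refine ⟨ModuleCat.ofHom { f with map_smul' := hf }, ?_⟩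
    ext m
    apply Subtype.ext
    change ∑ i ∈ s, x i • (g' (toCorner j M (y i • m.1))).1 = (g' m).1
    rw [Finset.sum_congr rfl fun i _ => congrArg (fun z : corner j N => x i • z.1) (hg (y i) m)]
    exact (expand (L := N) (g' m).1).symm

variable (j) in
/-- The `C`-equivariant additive maps `R → N`, that is, `Hom_C(eR, N)`: such a map satisfies
`φ r = φ (e r)`, so it is determined by its restriction to `eR`. -/
def coind (N : Type*) [AddCommGroup N] [Module C N] : AddSubgroup (R →+ N) where
  carrier := {φ | ∀ c r, φ (j c * r) = c • φ r}
  add_mem' {a b} ha hb c r := by simp [ha c r, hb c r]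
  zero_mem' c r := by simp
  neg_mem' {a} ha c r := by simp [ha c r]

instance (N : Type*) [AddCommGroup N] [Module C N] : Module R (coind j N) where
  smul r φ := ⟨φ.1.comp (AddMonoidHom.mulRight r), fun c s => by
    simpa [mul_assoc] using φ.2 c (s * r)⟩
  one_smul φ := Subtype.ext (AddMonoidHom.ext fun s => congrArg φ.1 (mul_one s))
  mul_smul r t φ := Subtype.ext (AddMonoidHom.ext fun s => congrArg φ.1 (mul_assoc s r t).symm)
  smul_zero r := rfl
  smul_add r φ ψ := rfl
  add_smul r t φ := Subtype.ext (AddMonoidHom.ext fun s =>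
    (congrArg φ.1 (mul_add s r t)).trans (map_add φ.1 _ _))
  zero_smul φ := Subtype.ext (AddMonoidHom.ext fun s =>
    (congrArg φ.1 (mul_zero s)).trans (map_zero φ.1))

/-- Evaluation at `1` identifies `e Hom_C(eR, N)` with `N`. -/
theorem essSurj (hinj : Function.Injective j) (hrange : ∀ r : R, ∃ c, j c = j 1 * r * j 1) :
    (functor j).EssSurj where
  mem_essImage N := by
    -- `γ : R → C` is the map `r ↦ e r e`
    choose γ hγ using hrange
    have γ_add : ∀ r t, γ (r + t) = γ r + γ t := fun r t => hinj (by
      rw [map_add, hγ, hγ, hγ, mul_add, add_mul])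
    have γ_mul : ∀ c r, γ (j c * r) = c * γ r := fun c r => hinj (by
      rw [map_mul, hγ, hγ, ← mul_assoc, ← mul_assoc, ← mul_assoc, one_mul_map, map_mul_one])
    have γ_mul_one : ∀ r, γ (r * j 1) = γ r := fun r => hinj (by
      rw [hγ, hγ, mul_assoc, mul_assoc, map_mul_one, ← mul_assoc])
    have γ_one : γ 1 = 1 := hinj (by rw [hγ, mul_one, one_mul_map])
    let ev : corner j (coind j N) →ₗ[C] N :=
      { toFun := fun φ => φ.1.1 1
        map_add' := fun φ ψ => rfl
        map_smul' := fun c φ => by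
          have := φ.1.2 c 1
          rw [mul_one] at this
          rw [RingHom.id_apply, ← this]
          exact congrArg φ.1.1 (one_mul (j c)) }
    have hev : Function.Bijective ev := by
      constructor
      · rw [injective_iff_map_eq_zero]
        intro φ hφ
        apply Subtype.ext; apply Subtype.ext; ext r
        have h1 : φ.1.1 (r * j 1) = φ.1.1 r := congrArg (fun ψ : coind j N => ψ.1 r) φ.2
        have h2 := φ.1.2 1 (r * j 1)
        have h3 := φ.1.2 (γ r) 1
        rw [mul_one, hγ, mul_assoc, h2, one_smul, h1] at h3
        rw [h3]
        change γ r • ev φ = 0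
        rw [hφ, smul_zero]
      · intro n
        let φ : coind j N := ⟨
          { toFun := fun r => γ r • n
            map_zero' := by
              rw [show γ 0 = 0 from hinj (by rw [hγ, map_zero, mul_zero, zero_mul]), zero_smul]
            map_add' := fun r t => by rw [γ_add, add_smul] },
          fun c r => by
            change γ (j c * r) • n = c • γ r • n
            rw [γ_mul, mul_smul]⟩
        refine ⟨⟨φ, ?_⟩, ?_⟩
        · apply Subtype.ext; ext r
          change γ (r * j 1) • n = γ r • n
          rw [γ_mul_one]
        · change γ 1 • n = n
          rw [γ_one, one_smul]
    exact ⟨ModuleCat.of R (coind j N),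
      ⟨(LinearEquiv.ofBijective ev hev).toModuleIso⟩⟩

open scoped ModuleCat.Algebra in
theorem linear : (functor j).Linear k where
  map_smul {M N} f c := by
    ext m
    apply Subtype.ext
    change algebraMap k R c • f.hom m.1 = j (algebraMap k C c) • f.hom m.1
    have hm : j 1 • f.hom m.1 = f.hom m.1 := (map_smul f.hom _ _).symm.trans (congrArg f.hom m.2)
    have hj : j (algebraMap k C c) = algebraMap k R c * j 1 := by
      rw [Algebra.algebraMap_eq_smul_one, map_smul, Algebra.smul_def]
    rw [hj]
    exact (congrArg (algebraMap k R c • ·) hm.symm).trans (mul_smul _ _ _).symm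

/-- If `j` identifies `C` with the corner `eRe` for an idempotent `e = j 1` with `ReR = R`, then
`R` and `C` are Morita equivalent. -/
theorem isMoritaEquivalent (hinj : Function.Injective j)
    (hrange : ∀ r : R, ∃ c, j c = j 1 * r * j 1)
    (hfull : Submodule.span k (Set.range fun p : R × R => p.1 * j 1 * p.2) = ⊤) :
    IsMoritaEquivalent k R C := by
  obtain ⟨s, x, y, hs⟩ := exists_sum_eq_one hfull
  have := faithful hs
  have := full hrange hs
  have := essSurj hinj hrange
  have : (functor j).IsEquivalence := {}
  exact ⟨⟨(functor j).asEquivalence, linear⟩⟩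

end FullCorner

/-! ### The antipode reverses the comultiplication -/

namespace PartialHopf

open Coalgebra HopfAlgebra

section Antipode

variable {k H B : Type*} [Field k] [Ring H] [HopfAlgebra k H] [Ring B] [Algebra k B]

theorem conv_algHom_antipode (f : H →ₐ[k] B) :
    conv f.toLinearMap (f.toLinearMap ∘ₗ antipode k) = Algebra.linearMap k B ∘ₗ counit := by
  ext h
  rw [conv_apply _ _ (ℛ k h)]
  simp [← map_mul, ← map_sum, sum_mul_antipode_eq_algebraMap_counit (ℛ k h)]

theorem conv_antipode_algHom (f : H →ₐ[k] B) :
    conv (f.toLinearMap ∘ₗ antipode k) f.toLinearMap = Algebra.linearMap k B ∘ₗ counit := by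
  ext h
  rw [conv_apply _ _ (ℛ k h)]
  simp [← map_mul, ← map_sum, sum_antipode_mul_eq_algebraMap_counit (ℛ k h)]

/-- The formula `Δ(S h) = S h₍₂₎ ⊗ S h₍₁₎`: both sides are convolution inverse to `Δ`. -/
theorem comul_antipode (h : H) : comul (R := k) (antipode k h) =
    ∑ i ∈ (ℛ k h).index, antipode k ((ℛ k h).right i) ⊗ₜ[k] antipode k ((ℛ k h).left i) := by
  let l : H →ₐ[k] H ⊗[k] H := Algebra.TensorProduct.includeLeft
  let r : H →ₐ[k] H ⊗[k] H := Algebra.TensorProduct.includeRight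
  let Δ : H →ₐ[k] H ⊗[k] H := Bialgebra.comulAlgHom k H
  have hΔ : Δ.toLinearMap = conv l.toLinearMap r.toLinearMap := by
    ext h
    rw [conv_apply _ _ (ℛ k h)]
    simp [Δ, l, r, (ℛ k h).eq]
  have hinv : conv Δ.toLinearMap
      (conv (r.toLinearMap ∘ₗ antipode k) (l.toLinearMap ∘ₗ antipode k)) =
        Algebra.linearMap k _ ∘ₗ counit := by
    rw [hΔ, conv_assoc, ← conv_assoc r.toLinearMap, conv_algHom_antipode, unit_conv,
      conv_algHom_antipode]
  have key : Δ.toLinearMap ∘ₗ antipode k =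
      conv (r.toLinearMap ∘ₗ antipode k) (l.toLinearMap ∘ₗ antipode k) := by
    rw [← conv_unit (Δ.toLinearMap ∘ₗ antipode k), ← hinv, ← conv_assoc, conv_antipode_algHom,
      unit_conv]
  have := LinearMap.congr_fun key h
  rw [conv_apply _ _ (ℛ k h)] at this
  simpa [Δ, l, r] using this

/-- If the values of `P` and `Q` commute, then `(P * Q) ∘ S = (Q ∘ S) * (P ∘ S)`. -/
theorem conv_comp_antipode {P Q : H →ₗ[k] B} (hPQ : ∀ x y, Commute (P x) (Q y)) :
    conv P Q ∘ₗ antipode k = conv (Q ∘ₗ antipode k) (P ∘ₗ antipode k) := by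
  ext h
  rw [conv_apply _ _ (ℛ k h)]
  simp only [conv, LinearMap.comp_apply, comul_antipode, map_sum, TensorProduct.map_tmul,
    LinearMap.mul'_apply]
  exact Finset.sum_congr rfl fun i _ => hPQ _ _

end Antipode

/-! ### Linearity of the elements of `{A, A}` -/

section Linearity

variable {k H A : Type*} [Field k] [Ring H] [HopfAlgebra k H] [Ring A] [Algebra k A]
  {ρ : H →ₗ[k] Module.End k A}

/-- `h₍₁₎ • (S(h₍₂₎) • a) = (h • 1) a`. -/
theorem IsPartialAction.conv_antipode (hρ : IsPartialAction ρ) (h : H) (a : A) :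
    conv ρ (ρ ∘ₗ antipode k) h a = ρ h 1 * a := by
  have h1 : ∀ x y : H, ρ x (ρ y a) = ∑ i ∈ (ℛ k x).index,
      ρ ((ℛ k x).left i) 1 * ρ ((ℛ k x).right i * y) a := fun x y => by
    rw [hρ.act_act_left, conv_apply _ _ (ℛ k x)]; rfl
  rw [conv_apply _ _ (ℛ k h)]
  simp only [LinearMap.sum_apply, Module.End.mul_apply, LinearMap.comp_apply, h1]
  let Ψ : H →ₗ[k] H →ₗ[k] H →ₗ[k] A :=
    LinearMap.mk₂ k (fun x y => LinearMap.mulLeft k (ρ x 1) ∘ₗ ρ.flip a ∘ₗ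
        LinearMap.mulLeft k y ∘ₗ antipode k)
      (by intros; ext; simp [add_mul]) (by intros; ext; simp)
      (by intros; ext; simp [add_mul, mul_add]) (by intros; ext; simp)
  have := sum_coassoc Ψ h
  simp only [Ψ, LinearMap.mk₂_apply, LinearMap.comp_apply, LinearMap.mulLeft_apply,
    LinearMap.flip_apply] at this
  rw [this]
  simp only [← Finset.mul_sum, ← LinearMap.sum_apply, ← map_sum, sum_mul_antipode_eq_smul]
  simp only [map_smul, LinearMap.smul_apply, hρ.one_act, mul_smul_comm]
  exact sum_counit_right (LinearMap.mulRight k a ∘ₗ ρ.flip 1) h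

/-- The operators `a ⊗ x ↦ h₍₁₎ • (S(h₍₂₎) • (a ⊗ x))` of the diagonal action only act on the first
factor, by left multiplication with `h • 1`. -/
theorem IsPartialAction.conv_diagAct_antipode (hρ : IsPartialAction ρ) (h : H) (a : A) (x : H) :
    conv (diagAct ρ) (diagAct ρ ∘ₗ antipode k) h (a ⊗ₜ x) = (ρ h 1 * a) ⊗ₜ x := by
  let P : H →ₗ[k] Module.End k (A ⊗[k] H) := LinearMap.rTensorHom H ∘ₗ ρ
  let Q : H →ₐ[k] Module.End k (A ⊗[k] H) := AlgHom.ofLinearMap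
    (LinearMap.lTensorHom A ∘ₗ LinearMap.mul k H)
    (by ext; simp) (fun x y => by ext; simp [mul_assoc])
  have hD : diagAct ρ = conv P Q.toLinearMap := by
    ext h a x
    simp [diagAct_tmul _ (ℛ k h), conv_apply _ _ (ℛ k h), P, Q]
  have hPQ : ∀ x y, Commute (P x) (Q.toLinearMap y) := fun x y => by
    ext; simp [P, Q]
  rw [hD, conv_comp_antipode hPQ, conv_assoc, ← conv_assoc Q.toLinearMap, conv_algHom_antipode,
    unit_conv, ← hρ.conv_antipode]
  simp [conv_apply _ _ (ℛ k h), P, TensorProduct.sum_tmul]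

theorem IsPartialAction.map_act_one_mul (hρ : IsPartialAction ρ) {f : A ⊗[k] H →ₗ[k] A}
    (hf : f ∈ homObj ρ ρ) (h : H) (a : A) (x : H) :
    f ((ρ h 1 * a) ⊗ₜ x) = ρ h 1 * f (a ⊗ₜ x) := by
  rw [← hρ.conv_diagAct_antipode, ← hρ.conv_antipode, conv_apply _ _ (ℛ k h),
    conv_apply _ _ (ℛ k h)]
  have hf' : ∀ h z, f (diagAct ρ h z) = ρ h (f z) := hf
  simp [LinearMap.sum_apply, hf']

end Linearity

/-! ### The universal property of `H_par` -/

section Universal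

variable {k H B : Type*} [Field k] [Ring H] [HopfAlgebra k H] [Ring B] [Algebra k B]

theorem IsPartialRep.lift_rel {π : H →ₗ[k] B} (hπ : IsPartialRep π) ⦃x y : TensorAlgebra k H⦄
    (hxy : HParRel k H x y) : TensorAlgebra.lift k π x = TensorAlgebra.lift k π y := by
  have hι : (TensorAlgebra.lift k π).toLinearMap ∘ₗ TensorAlgebra.ι k = π := by ext; simp
  have hc : ∀ f : H →ₗ[k] H, (TensorAlgebra.lift k π).toLinearMap ∘ₗ
      TensorAlgebra.ι k ∘ₗ f = π ∘ₗ f := fun f => by ext; simp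
  cases hxy with
  | map_one => simp [hπ.map_one]
  | mul_eps h l =>
    rw [map_mul, epsOf, map_conv, map_conv, hι, hc, hc, ← hπ.mul_eps]
    simp [epsOf]
  | eps_mul h l =>
    rw [map_mul, epsOf, map_conv, map_conv, hι, hc, hc, ← hπ.eps_mul]
    simp [epsOf]

/-- The algebra homomorphism `H_par → B` induced by a partial representation of `H` on `B`. -/
noncomputable def HPar.lift {π : H →ₗ[k] B} (hπ : IsPartialRep π) : HPar k H →ₐ[k] B :=
  RingQuot.liftAlgHom k ⟨TensorAlgebra.lift k π, hπ.lift_rel⟩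

theorem HPar.lift_bracket {π : H →ₗ[k] B} (hπ : IsPartialRep π) (h : H) :
    HPar.lift hπ (bracket k H h) = π h :=
  (RingQuot.liftAlgHom_mkAlgHom_apply k (TensorAlgebra.lift k π) hπ.lift_rel _).trans
    (TensorAlgebra.lift_ι_apply _ _)

theorem HPar.algHom_ext {φ ψ : HPar k H →ₐ[k] B}
    (h : ∀ x, φ (bracket k H x) = ψ (bracket k H x)) : φ = ψ := by
  refine RingQuot.ringQuot_ext' k φ ψ ?_
  ext x
  exact h x

end Universal

/-! ### The partial smash product as a target of partial representations -/

section PartialSmash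

variable {k H A : Type*} [Field k] [Ring H] [HopfAlgebra k H] [Ring A] [Algebra k A]
  {ρ : H →ₗ[k] Module.End k A} (hρ : IsPartialAction ρ)

/-- The surjection `z ↦ z (1 ⊗ 1)` of `A ⊗ H` onto the partial smash product. -/
noncomputable def PartialSmashProduct.proj : A ⊗[k] H →ₗ[k] PartialSmashProduct ρ hρ :=
  LinearMap.rangeRestrict ((smashMul ρ).flip (1 ⊗ₜ 1))

/-- The inclusion of the partial smash product into `A ⊗ H`. -/
noncomputable def PartialSmashProduct.incl : PartialSmashProduct ρ hρ →ₗ[k] A ⊗[k] H :=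
  (LinearMap.range ((smashMul ρ).flip (1 ⊗ₜ 1))).subtype

namespace PartialSmashProduct

theorem incl_injective : Function.Injective (incl hρ) := Subtype.val_injective

theorem incl_proj (z : A ⊗[k] H) : incl hρ (proj hρ z) = smashMul ρ z (1 ⊗ₜ 1) := rfl

theorem incl_mul (x y : PartialSmashProduct ρ hρ) :
    incl hρ (x * y) = smashMul ρ (incl hρ x) (incl hρ y) := rfl

theorem incl_one : incl hρ (1 : PartialSmashProduct ρ hρ) = 1 ⊗ₜ 1 := rfl

theorem proj_tmul (a : A) (h : H) : proj hρ (a ⊗ₜ h) = mk hρ a h := rfl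

theorem proj_incl (x : PartialSmashProduct ρ hρ) : proj hρ (incl hρ x) = x := mul_one x

theorem proj_smashMul (x y : A ⊗[k] H) :
    proj hρ (smashMul ρ x y) = proj hρ x * proj hρ y := by
  apply incl_injective hρ
  rw [incl_mul, incl_proj, incl_proj, incl_proj, hρ.smashMul_assoc, hρ.smashMul_assoc,
    hρ.one_smashMul]

/-- The map `h ↦ 1 # h`. -/
noncomputable def unitMk : H →ₗ[k] PartialSmashProduct ρ hρ := proj hρ ∘ₗ TensorProduct.mk k A H 1

theorem unitMk_apply (h : H) : unitMk hρ h = mk hρ 1 h := rfl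

end PartialSmashProduct

open PartialSmashProduct

/-- `(1 ⊗ h l₍₁₎)(1 ⊗ S(l₍₂₎) x) = (h₍₁₎ l • 1) ⊗ h₍₂₎ x`. -/
theorem sum_smashMul_antipode (ρ : H →ₗ[k] Module.End k A) (h l x : H) :
    ∑ i ∈ (ℛ k l).index, smashMul ρ ((1 : A) ⊗ₜ[k] (h * (ℛ k l).left i))
        (1 ⊗ₜ[k] (antipode k ((ℛ k l).right i) * x)) =
      ∑ i ∈ (ℛ k h).index, ρ ((ℛ k h).left i * l) 1 ⊗ₜ[k] ((ℛ k h).right i * x) := by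
  simp only [smashMul_tmul, diagAct_mul_tmul, map_sum, LinearMap.rTensor_tmul,
    LinearMap.mulLeft_apply, one_mul]
  rw [Finset.sum_comm]
  refine Finset.sum_congr rfl fun i _ => ?_
  let Ψ : H →ₗ[k] H →ₗ[k] H →ₗ[k] A ⊗[k] H := LinearMap.mk₂ k
    (fun y z => TensorProduct.mk k A H (ρ ((ℛ k h).left i * y) 1) ∘ₗ
      LinearMap.mulLeft k ((ℛ k h).right i * z) ∘ₗ LinearMap.mulRight k x ∘ₗ antipode k)
    (by intros; ext; simp [mul_add]) (by intros; ext; simp)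
    (by intros; ext; simp [add_mul, mul_add, mul_assoc, TensorProduct.tmul_add])
    (by intros; ext; simp [mul_assoc])
  have := sum_coassoc Ψ l
  simp only [Ψ, LinearMap.mk₂_apply, LinearMap.comp_apply, LinearMap.mulLeft_apply,
    LinearMap.mulRight_apply, TensorProduct.mk_apply] at this
  rw [this]
  simp only [mul_assoc]
  simp only [← TensorProduct.tmul_sum, ← Finset.mul_sum]
  simp only [← mul_assoc, ← Finset.sum_mul, sum_mul_antipode_eq_smul]
  simp only [smul_mul_assoc, mul_smul_comm, mul_one, TensorProduct.tmul_smul]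
  have := sum_counit_right ((TensorProduct.mk k A H).flip ((ℛ k h).right i * x) ∘ₗ
    ρ.flip 1 ∘ₗ LinearMap.mulLeft k ((ℛ k h).left i)) l
  simpa [mul_assoc] using this

theorem IsPartialAction.sum_smashMul_antipode (hρ : IsPartialAction ρ) (l x : H) :
    ∑ i ∈ (ℛ k l).index, smashMul ρ ((1 : A) ⊗ₜ[k] (ℛ k l).left i)
        (1 ⊗ₜ[k] (antipode k ((ℛ k l).right i) * x)) = ρ l 1 ⊗ₜ[k] x := by
  have h1 := PartialHopf.sum_smashMul_antipode ρ 1 l x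
  have h2 := hρ.one_smashMul (ρ l 1 ⊗ₜ[k] x)
  simp only [one_mul] at h1
  rw [h1, ← h2]
  let G : H →ₗ[k] H →ₗ[k] A ⊗[k] H := (TensorProduct.mk k A H).compl₁₂
    (ρ.flip 1 ∘ₗ LinearMap.mulRight k l) (LinearMap.mulRight k x)
  have h3 := congrArg (TensorProduct.lift G) (ℛ k (1 : H)).eq
  simp only [map_sum, Bialgebra.comul_one, Algebra.TensorProduct.one_def,
    TensorProduct.lift.tmul] at h3
  simp only [G, LinearMap.compl₁₂_apply, LinearMap.comp_apply, LinearMap.mulRight_apply,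
    TensorProduct.mk_apply, LinearMap.flip_apply, one_mul] at h3
  rw [h3, h2]

theorem epsOf_unitMk (l : H) : epsOf (unitMk hρ) l = mk hρ (ρ l 1) 1 := by
  rw [epsOf, conv_apply _ _ (ℛ k l), ← proj_tmul, ← hρ.sum_smashMul_antipode, map_sum]
  simp only [proj_smashMul, mul_one]
  rfl

/-- For a symmetric partial action, `h ↦ 1 # h` is a partial representation. -/
theorem unitMk_isPartialRep : IsPartialRep (unitMk hρ) where
  map_one := mul_one 1
  mul_eps h l := by
    have h1 : conv (unitMk hρ ∘ₗ LinearMap.mulLeft k h) (unitMk hρ ∘ₗ antipode k) l =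
        proj hρ (∑ i ∈ (ℛ k h).index, ρ ((ℛ k h).left i * l) 1 ⊗ₜ[k] (ℛ k h).right i) := by
      have := congrArg (proj hρ) (PartialHopf.sum_smashMul_antipode ρ h l 1)
      simp only [map_sum, proj_smashMul, mul_one] at this
      rw [conv_apply _ _ (ℛ k l), map_sum, ← this]
      rfl
    have h2 : smashMul ρ (∑ i ∈ (ℛ k h).index, ρ ((ℛ k h).left i * l) 1 ⊗ₜ[k] (ℛ k h).right i)
        (1 ⊗ₜ 1) = smashMul ρ (1 ⊗ₜ h) (ρ l 1 ⊗ₜ 1) := by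
      rw [smashMul_tmul_tmul _ _ _ (ℛ k h)]
      simp only [map_sum, LinearMap.sum_apply, smashMul_tmul_tmul _ _ _ (ℛ k _), mul_one, one_mul,
        hρ.act_act_right, conv_apply _ _ (ℛ k _), LinearMap.comp_apply, LinearMap.flip_apply,
        LinearMap.mulRight_apply, TensorProduct.sum_tmul]
      let Ψ : H →ₗ[k] H →ₗ[k] H →ₗ[k] A ⊗[k] H := LinearMap.mk₂ k
        (fun y z => TensorProduct.mk k A H (ρ (y * l) 1 * ρ z 1))
        (by intros; ext; simp [add_mul])
        (by intros; ext; simp [TensorProduct.smul_tmul'])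
        (by intros; ext; simp [mul_add])
        (by intros; ext; simp [TensorProduct.smul_tmul'])
      exact (sum_coassoc Ψ h).symm
    rw [epsOf_unitMk, h1, ← proj_tmul, unitMk_apply, ← proj_tmul, ← proj_smashMul, ← h2]
    apply incl_injective hρ
    rw [incl_proj, incl_proj, hρ.smashMul_assoc, hρ.one_smashMul]
  eps_mul h l := by
    rw [epsOf_unitMk, ← proj_tmul, unitMk_apply, ← proj_tmul, ← proj_smashMul]
    have h1 : smashMul ρ (ρ h 1 ⊗ₜ 1) (1 ⊗ₜ[k] l) = ρ h 1 ⊗ₜ l := by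
      have := congrArg (LinearMap.rTensor H (LinearMap.mulLeft k (ρ h 1)))
        (hρ.one_smashMul (1 ⊗ₜ l))
      rw [smashMul_tmul] at this ⊢
      simpa [LinearMap.mulLeft_one] using this
    rw [h1, ← hρ.sum_smashMul_antipode, map_sum, conv_apply _ _ (ℛ k h)]
    simp only [proj_smashMul]
    rfl

end PartialSmash

open PartialSmashProduct

/-! ### The isomorphism between the partial smash product and `H_par` -/

section Isomorphism

variable (k H : Type*) [Field k] [Ring H] [HopfAlgebra k H]

variable {k H} in
/-- `(h₍₁₎ ▹ b) π(h₍₂₎ l) = π(h) b π(l)` for `h ▹ b = π(h₍₁₎) b π(S(h₍₂₎))`. -/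
theorem IsPartialRep.conjOf_conv_mulRight {B : Type*} [Ring B] [Algebra k B] {π : H →ₗ[k] B}
    (hπ : IsPartialRep π) {b : B} (hb : IsGood π b) (h l : H) :
    conv (conjOf π b) (π ∘ₗ LinearMap.mulRight k l) h = π h * b * π l := by
  rw [← hπ.conv_conjOf_eps hb, conv_assoc, hπ.eps_conv_mulRight, conv_mulRight,
    ← hπ.mulRight_comp_of_good hb]
  rfl

/-- The map `a ⊗ h ↦ a [h]`. -/
noncomputable def mulBracket : APar k H ⊗[k] H →ₗ[k] HPar k H :=
  TensorProduct.lift ((LinearMap.mul k (HPar k H)).compl₁₂ (APar k H).val.toLinearMap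
    (bracket k H))

theorem mulBracket_tmul (a : APar k H) (h : H) :
    mulBracket k H (a ⊗ₜ h) = (a : HPar k H) * bracket k H h := rfl

theorem mulBracket_smashMul (x y : APar k H ⊗[k] H) :
    mulBracket k H (smashMul (aparAct k H) x y) = mulBracket k H x * mulBracket k H y := by
  induction x with
  | zero => simp
  | add x x' hx hx' => simp only [map_add, LinearMap.add_apply, add_mul, hx, hx']
  | tmul a h =>
  induction y with
  | zero => simp
  | add y y' hy hy' => simp only [map_add, mul_add, hy, hy']
  | tmul b l =>
    have := (bracket_isPartialRep k H).conjOf_conv_mulRight (APar.good_and_conj_mem b.2).1 h l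
    rw [conv_apply _ _ (ℛ k h)] at this
    rw [smashMul_tmul_tmul _ _ _ (ℛ k h), map_sum]
    simp only [mulBracket_tmul, Subalgebra.coe_mul, coe_aparAct, mul_assoc] at this ⊢
    rw [← this, Finset.mul_sum]
    rfl

/-- The algebra homomorphism `a # h ↦ a [h]`. -/
noncomputable def smashToHPar : APartialSmash k H →ₐ[k] HPar k H :=
  AlgHom.ofLinearMap (mulBracket k H ∘ₗ incl (aparAct_isPartialAction k H))
    (by
      rw [LinearMap.comp_apply, incl_one, mulBracket_tmul, (bracket_isPartialRep k H).map_one]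
      simp)
    (fun x y => by
      simp only [LinearMap.comp_apply, incl_mul, mulBracket_smashMul])

theorem smashToHPar_mk (a : APar k H) (h : H) :
    smashToHPar k H (mk (aparAct_isPartialAction k H) a h) =
      (a : HPar k H) * bracket k H h := by
  change mulBracket k H (incl _ (mk _ a h)) = _
  rw [← proj_tmul, incl_proj, mulBracket_smashMul, mulBracket_tmul, mulBracket_tmul,
    (bracket_isPartialRep k H).map_one]
  simp

/-- The algebra homomorphism `[h] ↦ 1 # h`. -/
noncomputable def hparToSmash : HPar k H →ₐ[k] APartialSmash k H :=
  HPar.lift (unitMk_isPartialRep (aparAct_isPartialAction k H))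

theorem hparToSmash_bracket (h : H) :
    hparToSmash k H (bracket k H h) = mk (aparAct_isPartialAction k H) 1 h :=
  HPar.lift_bracket _ h

theorem mk_one_mul_mk (a b : APar k H) (h : H) :
    mk (aparAct_isPartialAction k H) a 1 * mk (aparAct_isPartialAction k H) b h =
      mk (aparAct_isPartialAction k H) (a * b) h := by
  have h1 := congrArg (LinearMap.rTensor H (LinearMap.mulLeft k a))
    ((aparAct_isPartialAction k H).one_smashMul (b ⊗ₜ h))
  rw [smashMul_tmul, LinearMap.mulLeft_one, LinearMap.rTensor_id, LinearMap.id_apply,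
    LinearMap.rTensor_tmul] at h1
  simp only [← proj_tmul]
  rw [← proj_smashMul, smashMul_tmul, h1]
  rfl

/-- On `A_par`, the homomorphism `[h] ↦ 1 # h` is `a ↦ a # 1`; on generators this is the formula
`epsOf_unitMk`. -/
theorem hparToSmash_coe (a : APar k H) :
    hparToSmash k H (a : HPar k H) = mk (aparAct_isPartialAction k H) a 1 := by
  obtain ⟨a, ha⟩ := a
  change hparToSmash k H a = _
  induction ha using Algebra.adjoin_induction with
  | mem x hx =>
    obtain ⟨l, rfl⟩ := hx
    have h1 : (hparToSmash k H).toLinearMap ∘ₗ bracket k H =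
        unitMk (aparAct_isPartialAction k H) := by
      ext h; exact hparToSmash_bracket k H h
    have h2 : hparToSmash k H (eps k H l) = epsOf (unitMk (aparAct_isPartialAction k H)) l := by
      rw [eps, epsOf, map_conv, ← LinearMap.comp_assoc, h1, epsOf]
    rw [h2, epsOf_unitMk]
    congr 1
    apply Subtype.ext
    rw [coe_aparAct]
    exact LinearMap.congr_fun (IsPartialRep.conjOf_one (bracket k H)) l
  | algebraMap r =>
    rw [AlgHom.commutes, Algebra.algebraMap_eq_smul_one]
    have : (⟨algebraMap k (HPar k H) r, Subalgebra.algebraMap_mem _ r⟩ : APar k H) = r • 1 :=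
      Subtype.ext (Algebra.algebraMap_eq_smul_one r)
    rw [this, ← proj_tmul, ← TensorProduct.smul_tmul', map_smul]
    congr 1
    exact ((unitMk_isPartialRep (aparAct_isPartialAction k H)).map_one).symm
  | add x y hx hy ihx ihy =>
    rw [map_add, ihx, ihy, ← proj_tmul, ← proj_tmul, ← map_add, ← TensorProduct.add_tmul]
    rfl
  | mul x y hx hy ihx ihy =>
    rw [map_mul, ihx, ihy, mk_one_mul_mk]
    rfl

/-- The isomorphism `A_par # H ≃ H_par`, `a # h ↦ a [h]`. -/
noncomputable def smashEquivHPar : APartialSmash k H ≃ₐ[k] HPar k H :=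
  AlgEquiv.ofAlgHom (smashToHPar k H) (hparToSmash k H)
    (HPar.algHom_ext fun h => by
      change smashToHPar k H (hparToSmash k H (bracket k H h)) = bracket k H h
      rw [hparToSmash_bracket, smashToHPar_mk]
      simp)
    (by
      have h1 : ∀ z, hparToSmash k H (smashToHPar k H (proj (aparAct_isPartialAction k H) z)) =
          proj (aparAct_isPartialAction k H) z := by
        intro z
        induction z with
        | zero => simp
        | add x y hx hy => rw [map_add, map_add, map_add, hx, hy]
        | tmul a h =>
          rw [proj_tmul, smashToHPar_mk, map_mul, hparToSmash_coe, hparToSmash_bracket,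
            mk_one_mul_mk, mul_one]
      ext x
      rw [← proj_incl _ x]
      exact h1 _)

end Isomorphism

/-! ### The partial smash product as a corner of `H_glob` -/

section Corner

variable (k H : Type*) [Field k] [Ring H] [HopfAlgebra k H]

variable {k H} in
/-- The elements of `{A_par, A_par}` are `A_par`-linear in the first tensor factor, because `A_par`
is generated by the elements `ε_h = h • 1`. -/
theorem APar.map_mul_tmul {f : APar k H ⊗[k] H →ₗ[k] APar k H}
    (hf : f ∈ homObj (aparAct k H) (aparAct k H)) (a b : APar k H) (x : H) :
    f ((a * b) ⊗ₜ x) = a * f (b ⊗ₜ x) := by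
  obtain ⟨a, ha⟩ := a
  induction ha using Algebra.adjoin_induction generalizing b with
  | mem y hy =>
    obtain ⟨l, rfl⟩ := hy
    have hl : eps k H l ∈ APar k H := Algebra.subset_adjoin ⟨l, rfl⟩
    have : (⟨eps k H l, hl⟩ : APar k H) = aparAct k H l 1 :=
      Subtype.ext (LinearMap.congr_fun (IsPartialRep.conjOf_one (bracket k H)) l).symm
    change f ((⟨eps k H l, hl⟩ * b) ⊗ₜ x) = ⟨eps k H l, hl⟩ * f (b ⊗ₜ x)
    rw [this]
    exact (aparAct_isPartialAction k H).map_act_one_mul hf l b x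
  | algebraMap r =>
    have : (⟨algebraMap k (HPar k H) r, Subalgebra.algebraMap_mem _ r⟩ : APar k H) = r • 1 :=
      Subtype.ext (Algebra.algebraMap_eq_smul_one r)
    rw [this, smul_one_mul, smul_one_mul, ← TensorProduct.smul_tmul', map_smul]
  | add y z hy hz ihy ihz =>
    have : (⟨y + z, add_mem hy hz⟩ : APar k H) = ⟨y, hy⟩ + ⟨z, hz⟩ := rfl
    rw [this, add_mul, add_mul, TensorProduct.add_tmul, map_add, ihy, ihz]
  | mul y z hy hz ihy ihz =>
    have : (⟨y * z, mul_mem hy hz⟩ : APar k H) = ⟨y, hy⟩ * ⟨z, hz⟩ := rfl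
    rw [this, mul_assoc, ihy, ihz, mul_assoc]

theorem theta_apply_tmul (a b : APar k H) (h : H) :
    (theta k H a).1 (b ⊗ₜ h) = b * aparAct k H h a := rfl

/-- `θ(A_par)` is a right ideal of `{A_par, A_par}`. -/
theorem theta_mul (a : APar k H) (f : EndAPar k H) :
    theta k H a * f = theta k H (f.1 (a ⊗ₜ 1)) := by
  apply Subtype.ext
  ext b h
  change ((f.1 (coext (theta k H a).1 (b ⊗ₜ h)) : APar k H) : HPar k H) =
    (b * aparAct k H h (f.1 (a ⊗ₜ 1)) : APar k H)
  congr 1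
  have hf : ∀ h z, f.1 (diagAct (aparAct k H) h z) = aparAct k H h (f.1 z) := f.2
  rw [coext_tmul _ (ℛ k h), map_sum, ← hf, diagAct_tmul _ (ℛ k h), map_sum, Finset.mul_sum]
  exact Finset.sum_congr rfl fun i _ => by
    rw [theta_apply_tmul, APar.map_mul_tmul f.2, mul_one]

theorem theta_mul_endAct_theta (a b : APar k H) (h : H) :
    theta k H a * endAct (aparAct k H) h (theta k H b) = theta k H (a * aparAct k H h b) := by
  rw [theta_mul]
  congr 1
  change (theta k H b).1 (a ⊗ₜ (1 * h)) = _
  rw [one_mul, theta_apply_tmul]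

theorem theta_injective : Function.Injective (theta k H) := by
  intro a b hab
  have := congrArg (fun f : EndAPar k H => f.1 (1 ⊗ₜ 1)) hab
  simpa [theta_apply_tmul, (aparAct_isPartialAction k H).one_act] using this

/-- The identification of `{A_par, A_par} ⊗ H` with the underlying space of `H_glob`, which sends
`f ⊗ h` to `f # h`. -/
noncomputable def HGlob.ofTensor : EndAPar k H ⊗[k] H ≃ₗ[k] HGlob k H := LinearEquiv.refl k _

theorem HGlob.ofTensor_mul (x y : EndAPar k H ⊗[k] H) :
    HGlob.ofTensor k H x * HGlob.ofTensor k H y =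
      HGlob.ofTensor k H (smashMul (endAct (aparAct k H)) x y) := rfl

theorem HGlob.one_eq : (1 : HGlob k H) = HGlob.ofTensor k H (1 ⊗ₜ 1) := rfl

/-- The map `θ ⊗ H` from `A_par ⊗ H` to `H_glob`. -/
noncomputable def thetaSmash : APar k H ⊗[k] H →ₗ[k] HGlob k H :=
  (HGlob.ofTensor k H).toLinearMap ∘ₗ LinearMap.rTensor H (theta k H)

theorem thetaSmash_tmul (a : APar k H) (h : H) :
    thetaSmash k H (a ⊗ₜ h) = HGlob.ofTensor k H (theta k H a ⊗ₜ h) := rfl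

theorem thetaSmash_injective : Function.Injective (thetaSmash k H) :=
  (HGlob.ofTensor k H).injective.comp
    (Module.Flat.rTensor_preserves_injective_linearMap _ (theta_injective k H))

theorem thetaSmash_smashMul (x y : APar k H ⊗[k] H) :
    thetaSmash k H (smashMul (aparAct k H) x y) = thetaSmash k H x * thetaSmash k H y := by
  induction x with
  | zero => simp
  | add x x' hx hx' => simp only [map_add, LinearMap.add_apply, add_mul, hx, hx']
  | tmul a h =>
  induction y with
  | zero => simp
  | add y y' hy hy' => simp only [map_add, mul_add, hy, hy']
  | tmul b l =>
    rw [thetaSmash_tmul, thetaSmash_tmul, HGlob.ofTensor_mul, smashMul_tmul_tmul _ _ _ (ℛ k h),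
      smashMul_tmul_tmul _ _ _ (ℛ k h), map_sum, map_sum]
    simp only [thetaSmash_tmul, theta_mul_endAct_theta]

/-- The non-unital embedding `a [h] ↦ θ(a)(h₍₁₎ ⇀ θ(1)) # h₍₂₎` of `H_par` into `H_glob`. -/
noncomputable def hparToHGlob : HPar k H →ₙₐ[k] HGlob k H where
  toFun x := thetaSmash k H (incl _ ((smashEquivHPar k H).symm x))
  map_smul' c x := by simp
  map_zero' := by simp
  map_add' x y := by simp
  map_mul' x y := by rw [map_mul, incl_mul, thetaSmash_smashMul]

theorem hparToHGlob_one : hparToHGlob k H 1 = HGlob.ofTensor k H (theta k H 1 ⊗ₜ 1) := by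
  change thetaSmash k H (incl _ ((smashEquivHPar k H).symm 1)) = _
  rw [map_one, incl_one, thetaSmash_tmul]

theorem hparToHGlob_injective : Function.Injective (hparToHGlob k H) :=
  (thetaSmash_injective k H).comp
    ((incl_injective _).comp (smashEquivHPar k H).symm.injective)

theorem hparToHGlob_proj (z : APar k H ⊗[k] H) :
    hparToHGlob k H (smashEquivHPar k H (proj _ z)) =
      thetaSmash k H z * hparToHGlob k H 1 := by
  change thetaSmash k H (incl _ ((smashEquivHPar k H).symm _)) = _
  rw [AlgEquiv.symm_apply_apply, incl_proj, thetaSmash_smashMul, hparToHGlob_one, thetaSmash_tmul]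

/-- The image of `H_par` in `H_glob` is the corner of the idempotent `θ(1) # 1`. -/
theorem hparToHGlob_range (r : HGlob k H) :
    ∃ c, hparToHGlob k H c = hparToHGlob k H 1 * r * hparToHGlob k H 1 := by
  obtain ⟨z, rfl⟩ := (HGlob.ofTensor k H).surjective r
  suffices h : ∃ w, thetaSmash k H w = hparToHGlob k H 1 * HGlob.ofTensor k H z by
    obtain ⟨w, hw⟩ := h
    exact ⟨_, (hparToHGlob_proj k H w).trans (by rw [hw])⟩
  induction z with
  | zero => exact ⟨0, by simp⟩
  | add x y hx hy =>
    obtain ⟨v, hv⟩ := hx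
    obtain ⟨w, hw⟩ := hy
    exact ⟨v + w, by rw [map_add, map_add, mul_add, hv, hw]⟩
  | tmul f h =>
    refine ⟨f.1 (1 ⊗ₜ 1) ⊗ₜ h, ?_⟩
    have h1 := congrArg (LinearMap.rTensor H (LinearMap.mulLeft k (theta k H 1)))
      ((endAct_isModuleAlgebra (aparAct k H)).isPartialAction.one_smashMul (f ⊗ₜ h))
    rw [smashMul_tmul, LinearMap.mulLeft_one, LinearMap.rTensor_id, LinearMap.id_apply,
      LinearMap.rTensor_tmul, LinearMap.mulLeft_apply, theta_mul] at h1
    rw [hparToHGlob_one, HGlob.ofTensor_mul, smashMul_tmul, h1, thetaSmash_tmul]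

/-- `(1 # h₍₁₎)(f # 1)(1 # S(h₍₂₎)) = (h ⇀ f) # 1`. -/
theorem HGlob.sum_conj (f : EndAPar k H) (h : H) :
    ∑ i ∈ (ℛ k h).index, HGlob.ofTensor k H (1 ⊗ₜ (ℛ k h).left i) *
        HGlob.ofTensor k H (f ⊗ₜ 1) * HGlob.ofTensor k H (1 ⊗ₜ antipode k ((ℛ k h).right i)) =
      HGlob.ofTensor k H (endAct (aparAct k H) h f ⊗ₜ 1) := by
  have hρ := endAct_isModuleAlgebra (aparAct k H)
  have h1 : ∀ (g : EndAPar k H) (x y : H), HGlob.ofTensor k H (g ⊗ₜ x) *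
      HGlob.ofTensor k H (1 ⊗ₜ y) = HGlob.ofTensor k H (g ⊗ₜ (x * y)) := by
    intro g x y
    rw [HGlob.ofTensor_mul, smashMul_tmul_tmul _ _ _ (ℛ k x)]
    congr 1
    have := sum_counit_left (TensorProduct.mk k (EndAPar k H) H g ∘ₗ LinearMap.mulRight k y) x
    simpa [hρ.act_one, ← Algebra.commutes, ← Algebra.smul_def, TensorProduct.smul_tmul'] using this
  have h2 : ∀ x, HGlob.ofTensor k H (1 ⊗ₜ x) * HGlob.ofTensor k H (f ⊗ₜ 1) =
      ∑ i ∈ (ℛ k x).index,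
        HGlob.ofTensor k H (endAct (aparAct k H) ((ℛ k x).left i) f ⊗ₜ (ℛ k x).right i) := by
    intro x
    rw [HGlob.ofTensor_mul, smashMul_tmul_tmul _ _ _ (ℛ k x)]
    simp
  simp only [h2, Finset.sum_mul, h1]
  let Ψ : H →ₗ[k] H →ₗ[k] H →ₗ[k] HGlob k H := LinearMap.mk₂ k
    (fun x y => (HGlob.ofTensor k H).toLinearMap ∘ₗ
      TensorProduct.mk k (EndAPar k H) H (endAct (aparAct k H) x f) ∘ₗ
        LinearMap.mulLeft k y ∘ₗ antipode k)
    (by intros; ext; simp)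
    (by intros; ext; simp)
    (by intros; ext; simp [add_mul, TensorProduct.tmul_add])
    (by intros; ext; simp)
  refine (sum_coassoc Ψ h).trans ?_
  simp only [Ψ, LinearMap.mk₂_apply, LinearMap.comp_apply, LinearMap.mulLeft_apply,
    TensorProduct.mk_apply, ← map_sum, ← TensorProduct.tmul_sum, sum_mul_antipode_eq_smul]
  have h3 := sum_counit_right ((TensorProduct.mk k (EndAPar k H) H).flip 1 ∘ₗ
    (endAct (aparAct k H)).flip f) h
  simp only [LinearMap.comp_apply, LinearMap.flip_apply, TensorProduct.mk_apply,
    ← TensorProduct.tmul_smul] at h3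
  exact congrArg (HGlob.ofTensor k H) h3

/-- If the globalization is proper, the ideal of `H_glob` generated by `θ(1) # 1` contains
`(h ⇀ θ(a)) # 1` for all `h` and `a`, hence `1`. -/
theorem hparToHGlob_full (hproper : IsProperGlobalization k H) :
    Submodule.span k (Set.range fun p : HGlob k H × HGlob k H =>
      p.1 * hparToHGlob k H 1 * p.2) = ⊤ := by
  set I := Submodule.span k (Set.range fun p : HGlob k H × HGlob k H =>
      p.1 * hparToHGlob k H 1 * p.2) with hI
  have mem : ∀ x y, x * hparToHGlob k H 1 * y ∈ I := fun x y =>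
    Submodule.subset_span ⟨(x, y), rfl⟩
  have mul_mem : ∀ x z, x ∈ I → x * z ∈ I := by
    intro x z hx
    induction hx using Submodule.span_induction with
    | mem x hx =>
      obtain ⟨p, rfl⟩ := hx
      change p.1 * hparToHGlob k H 1 * p.2 * z ∈ I
      rw [mul_assoc]
      exact mem _ _
    | zero => rw [zero_mul]; exact zero_mem _
    | add x y _ _ hx hy => rw [add_mul]; exact add_mem hx hy
    | smul c x _ hx => rw [smul_mul_assoc]; exact I.smul_mem c hx
  have theta_mem : ∀ f : EndAPar k H, HGlob.ofTensor k H (f ⊗ₜ 1) ∈ I := by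
    intro f
    have hf : f ∈ Submodule.span k
        {f | ∃ (h : H) (a : APar k H), endAct (aparAct k H) h (theta k H a) = f} := by
      rw [show Submodule.span k _ = ⊤ from hproper]; trivial
    induction hf using Submodule.span_induction with
    | mem f hf =>
      obtain ⟨h, a, rfl⟩ := hf
      rw [← HGlob.sum_conj]
      have ha : HGlob.ofTensor k H (theta k H a ⊗ₜ 1) =
          hparToHGlob k H 1 * HGlob.ofTensor k H (theta k H a ⊗ₜ 1) := by
        rw [hparToHGlob_one, ← thetaSmash_tmul, ← thetaSmash_tmul, ← thetaSmash_smashMul,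
          (aparAct_isPartialAction k H).one_smashMul]
      refine sum_mem fun i _ => ?_
      rw [ha, ← mul_assoc, mul_assoc (_ * _)]
      exact mem _ _
    | zero => rw [TensorProduct.zero_tmul, map_zero]; exact zero_mem _
    | add x y _ _ hx hy => rw [TensorProduct.add_tmul, map_add]; exact add_mem hx hy
    | smul c x _ hx => rw [← TensorProduct.smul_tmul', map_smul]; exact I.smul_mem c hx
  rw [eq_top_iff]
  intro r _
  rw [← one_mul r, HGlob.one_eq]
  exact mul_mem _ _ (theta_mem 1)

end Corner

end PartialHopf

theorem mainTheorem5 {k H : Type*} [Field k] [Ring H] [HopfAlgebra k H]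
    (hS : Function.Bijective (HopfAlgebra.antipode k (A := H)))
    (hproper : PartialHopf.IsProperGlobalization k H) :
    IsMoritaEquivalent k (PartialHopf.HGlob k H) (PartialHopf.HPar k H) ∧
      ∃ σ : PartialHopf.APartialSmash k H ≃ₐ[k] PartialHopf.HPar k H,
        ∀ (a : PartialHopf.APar k H) (h : H),
          σ (PartialHopf.PartialSmashProduct.mk (PartialHopf.aparAct_isPartialAction k H) a h) =
            (a : PartialHopf.HPar k H) * PartialHopf.bracket k H h :=
  ⟨FullCorner.isMoritaEquivalent (PartialHopf.hparToHGlob_injective k H)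
      (PartialHopf.hparToHGlob_range k H) (PartialHopf.hparToHGlob_full k H hproper),
    PartialHopf.smashEquivHPar k H, PartialHopf.smashToHPar_mk k H⟩
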